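/- Let $\alpha,\beta,\delta,\kappa>0$, $\theta,\hat\theta_0\in\mathbb R^n$. Let $\phi:[0,\infty)\to\mathbb R^n$ be continuous (for instance smooth) and bounded, let $z:[0,\infty)\to\mathbb R$ be continuous with $z(t)=\phi(t)^\top\theta+\varepsilon(t)$, where the noise $\varepsilon$ is bounded. Assume that $\phi$ has deficiency of excitation of order $q$, $0\le q\le n$: there are $T>0$ and positive semidefinite $n\times n$ matrices $\Phi_a,\Phi_b$ of rank $n-q$ such that $\Phi_a\le\int_t^{t+T}\phi(\tau)\phi(\tau)^\top d\tau\le\Phi_b$ for all $t\ge0$. Consider the cost $$J_t(\vartheta)=\tfrac12\int_0^t e^{-\beta(t-\tau)}\big(z(\tau)-\vartheta^\top\phi(\tau)\big)^2d\tau+\tfrac{\alpha}{2}e^{-\beta t}\|\vartheta-\hat\theta_0\|^2 .$$ For $\gamma>0$ consider the following estimator on $[0,\infty)$: $$\dot Q=-\beta Q+\phi\phi^\top,\quad Q(0)=0,$$ $$\dot P(t)=-\gamma P(t)+\gamma I-\gamma^2\int_0^t e^{-\gamma(t-\tau)}\bar N_u(\tau)\bar N_u(\tau)^\top d\tau,\quad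 P(0)=0,$$ where for $k\delta\le\tau<(k+1)\delta$, $k=0,1,2,\dots$, the columns of $\bar N_u(\tau)=\hat N_u(k\delta)$ form an orthonormal basis of $\operatorname{Ker}Q(k\delta)$; $$\dot\varphi=-\beta\varphi+z\phi,\quad\varphi(0)=\alpha\hat\theta_0,\qquad \dot\Omega=\beta\Omega-\Omega R\Omega,\quad\Omega(0)=\kappa^{-1}I,$$ $$R=P\phi\phi^\top P+\kappa\beta(I-P)+\dot PQP+PQ\dot P+(\alpha e^{-\beta t}-\kappa)\dot P,$$ $$\dot{\hat\theta}_d=-\Omega\big(R\hat\theta_d-zP\phi-\dot P\varphi\big),\quad\hat\theta_d(0)=0,\qquad \hat\theta=\hat\theta_d+(I-P)\hat\theta_0 .$$ Then: 1. For every $t\ge0$ the cost $J_t$ has a unique minimizer $\theta^*(t)$, and for every $\gamma>0$ the estimator equations have a solution on all of $[0,\infty)$. 2. For every $\gamma>0$ and every such solution there are $\rho_a,\rho_b>0$ with $\|\hat\theta(t)-\theta^*(t)\|\le\rho_a e^{-\rho_b t}$ for all $t\ge0$. 3. The decay rate can be made arbitrarily fast by increasing $\gamma$: for every $\rho_b>0$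 there is $\gamma_0>0$ such that for every $\gamma>\gamma_0$ and every solution there is $\rho_a>0$ with $\|\hat\theta(t)-\theta^*(t)\|\le\rho_a e^{-\rho_b t}$ for all $t\ge0$. 4. In the noise-free case $\varepsilon\equiv0$, let $N_d\in\mathbb R^{n\times(n-q)}$ have orthonormal columns spanning the identifiable subspace $\operatorname{Im}\Phi_a$ (for any admissible $T,\Phi_a,\Phi_b$). If $\gamma>\beta/2$, then for every solution there is $\rho_c>0$ with $\|N_d^\top(\hat\theta(t)-\theta)\|\le\rho_c e^{-(\beta/2)t}$ for all $t\ge0$. -/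

import Mathlib

open Set
open scoped Matrix

namespace ParamLearning

/-- Euclidean norm of a real coordinate vector. -/
noncomputable def eucl {m : ℕ} (v : Fin m → ℝ) : ℝ :=
  ‖(WithLp.toLp 2 v : EuclideanSpace ℝ (Fin m))‖

/-- The columns of `N` form an orthonormal basis of the subspace `S` of `ℝⁿ`. -/
def IsOrthonormalBasisOf {n m : ℕ} (N : Matrix (Fin n) (Fin m) ℝ)
    (S : Submodule ℝ (Fin n → ℝ)) : Prop :=
  Nᵀ * N = 1 ∧ LinearMap.range N.mulVecLin = S

/-- The excitation matrix `∫_t^{t+T} φ(τ) φ(τ)ᵀ dτ`. -/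
noncomputable def excitation {n : ℕ} (φ : ℝ → Fin n → ℝ) (T t : ℝ) :
    Matrix (Fin n) (Fin n) ℝ :=
  Matrix.of fun i j => ∫ τ in t..(t + T), φ τ i * φ τ j

/-- `T`, `Φa`, `Φb` witness that `φ` has deficiency of excitation of order `q`: `Φa` and `Φb`
are positive semidefinite of rank `n - q`, and `Φa ≤ ∫_t^{t+T} φ φᵀ ≤ Φb` for all `t ≥ 0`
(in the Loewner order). -/
structure ExcitationBounds {n : ℕ} (φ : ℝ → Fin n → ℝ) (q : ℕ) (T : ℝ)
    (Φa Φb : Matrix (Fin n) (Fin n) ℝ) : Prop where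
  order_le : q ≤ n
  T_pos : 0 < T
  posSemidef_a : Φa.PosSemidef
  posSemidef_b : Φb.PosSemidef
  rank_a : Φa.rank = n - q
  rank_b : Φb.rank = n - q
  lower : ∀ t : ℝ, 0 ≤ t → (excitation φ T t - Φa).PosSemidef
  upper : ∀ t : ℝ, 0 ≤ t → (Φb - excitation φ T t).PosSemidef

/-- Deficient excitation of order `q`. -/
def DeficientExcitation {n : ℕ} (φ : ℝ → Fin n → ℝ) (q : ℕ) : Prop :=
  ∃ (T : ℝ) (Φa Φb : Matrix (Fin n) (Fin n) ℝ), ExcitationBounds φ q T Φa Φb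

/-- The discounted, regularized least-squares cost at time `t`, as a function of `ϑ`. -/
noncomputable def cost {n : ℕ} (α β : ℝ) (θ₀ : Fin n → ℝ) (φ : ℝ → Fin n → ℝ) (z : ℝ → ℝ)
    (t : ℝ) (ϑ : Fin n → ℝ) : ℝ :=
  (1 / 2) * (∫ τ in (0 : ℝ)..t, Real.exp (-β * (t - τ)) * (z τ - ϑ ⬝ᵥ φ τ) ^ 2)
    + (α / 2) * Real.exp (-β * t) * eucl (ϑ - θ₀) ^ 2

/-- `ϑ` minimizes the cost at time `t`. -/
def IsLeastSquares {n : ℕ} (α β : ℝ) (θ₀ : Fin n → ℝ) (φ : ℝ → Fin n → ℝ) (z : ℝ → ℝ)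
    (t : ℝ) (ϑ : Fin n → ℝ) : Prop :=
  ∀ ϑ' : Fin n → ℝ, cost α β θ₀ φ z t ϑ ≤ cost α β θ₀ φ z t ϑ'

/-- The matrix signal `X`, considered on `[0, ∞)`, has derivative `X'` at `t`
(entrywise; one-sided at `t = 0`). -/
def HasMatrixDerivAt {n : ℕ} (X : ℝ → Matrix (Fin n) (Fin n) ℝ)
    (X' : Matrix (Fin n) (Fin n) ℝ) (t : ℝ) : Prop :=
  ∀ i j, HasDerivWithinAt (fun s => X s i j) (X' i j) (Ici 0) t

/-- The right-hand side
`-γ P(t) + γ I - γ² ∫₀ᵗ e^{-γ(t-τ)} N̄(τ) N̄(τ)ᵀ dτ` of the equation for `P`, where `N̄(τ) = N̂ k`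
for `kδ ≤ τ < (k+1)δ`. -/
noncomputable def projectorRate {n : ℕ} (γ δ : ℝ) {r : ℕ → ℕ}
    (Nhat : (k : ℕ) → Matrix (Fin n) (Fin (r k)) ℝ)
    (P : ℝ → Matrix (Fin n) (Fin n) ℝ) (t : ℝ) : Matrix (Fin n) (Fin n) ℝ :=
  -(γ • P t) + γ • (1 : Matrix (Fin n) (Fin n) ℝ)
    - γ ^ 2 • Matrix.of fun i j =>
        ∫ τ in (0 : ℝ)..t, Real.exp (-γ * (t - τ)) * (Nhat ⌊τ / δ⌋₊ * (Nhat ⌊τ / δ⌋₊)ᵀ) i j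

/-- The matrix `R(t)` computed from the values `P`, `Q`, `Pdot = Ṗ` and `φ` at time `t`. -/
noncomputable def riccatiWeight {n : ℕ} (α β κ t : ℝ) (P Q Pdot : Matrix (Fin n) (Fin n) ℝ)
    (φ : Fin n → ℝ) : Matrix (Fin n) (Fin n) ℝ :=
  P * Matrix.vecMulVec φ φ * P + (κ * β) • (1 - P) + Pdot * Q * P + P * Q * Pdot
    + (α * Real.exp (-β * t) - κ) • Pdot

/-- A run on `[0, ∞)` of the online parameter estimator driven by the regressor `φ` and the
measurement `z`, with prior estimate `θ₀` and design parameters `α β γ δ κ`. -/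
structure EstimatorRun {n : ℕ} (α β γ δ κ : ℝ) (θ₀ : Fin n → ℝ) (φ : ℝ → Fin n → ℝ)
    (z : ℝ → ℝ) where
  /-- Discounted information matrix. -/
  Q : ℝ → Matrix (Fin n) (Fin n) ℝ
  Q_zero : Q 0 = 0
  Q_ode : ∀ t : ℝ, 0 ≤ t →
    HasMatrixDerivAt Q (-(β • Q t) + Matrix.vecMulVec (φ t) (φ t)) t
  /-- Number of columns of `Nhat k`. -/
  r : ℕ → ℕ
  /-- Sampled orthonormal basis of the kernel of `Q`. -/
  Nhat : (k : ℕ) → Matrix (Fin n) (Fin (r k)) ℝ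
  Nhat_basis : ∀ k : ℕ,
    IsOrthonormalBasisOf (Nhat k) (LinearMap.ker (Q ((k : ℝ) * δ)).mulVecLin)
  /-- Estimate of the projector onto the identifiable subspace. -/
  P : ℝ → Matrix (Fin n) (Fin n) ℝ
  P_zero : P 0 = 0
  P_ode : ∀ t : ℝ, 0 ≤ t → HasMatrixDerivAt P (projectorRate γ δ Nhat P t) t
  /-- The filtered data vector (driven by `z φ`, with forgetting factor `β`). -/
  varphi : ℝ → Fin n → ℝ
  varphi_zero : varphi 0 = α • θ₀
  varphi_ode : ∀ t : ℝ, 0 ≤ t →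
    HasDerivWithinAt varphi (-(β • varphi t) + z t • φ t) (Ici 0) t
  /-- Riccati-type gain. -/
  Ω : ℝ → Matrix (Fin n) (Fin n) ℝ
  Ω_zero : Ω 0 = κ⁻¹ • (1 : Matrix (Fin n) (Fin n) ℝ)
  Ω_ode : ∀ t : ℝ, 0 ≤ t →
    HasMatrixDerivAt Ω
      (β • Ω t
        - Ω t * riccatiWeight α β κ t (P t) (Q t) (projectorRate γ δ Nhat P t) (φ t) * Ω t) t
  /-- Component of the estimate in the (estimated) identifiable subspace. -/
  θd : ℝ → Fin n → ℝ
  θd_zero : θd 0 = 0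
  θd_ode : ∀ t : ℝ, 0 ≤ t →
    HasDerivWithinAt θd
      (-(Ω t *ᵥ
          (riccatiWeight α β κ t (P t) (Q t) (projectorRate γ δ Nhat P t) (φ t) *ᵥ θd t
            - z t • (P t *ᵥ φ t) - projectorRate γ δ Nhat P t *ᵥ varphi t))) (Ici 0) t

/-- The parameter estimate `θ̂ = θ̂_d + θ̂_u` with `θ̂_u = (I - P) θ̂₀`. -/
noncomputable def EstimatorRun.θhat {n : ℕ} {α β γ δ κ : ℝ} {θ₀ : Fin n → ℝ}
    {φ : ℝ → Fin n → ℝ} {z : ℝ → ℝ} (E : EstimatorRun α β γ δ κ θ₀ φ z) (t : ℝ) : Fin n → ℝ :=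
  E.θd t + (1 - E.P t) *ᵥ θ₀

end ParamLearning

open ParamLearning

/-!
Let `U` be the subspace of directions never excited by `φ`. Equality of the ranks of `Φa` and `Φb`
forces `U = ker Φa` (`ExcitationBounds.ker_eq`), and `ker Q(t) = U` as soon as `t ≥ T`
(`FilterRun.ker_Q`). Hence the sampled projector eventually equals the projector `S` onto `U`, and
the filtered projector satisfies `P - (1 - S) = e^{-γt} (affine in t)` from then on
(`FilterRun.P_entry_decay`); it decays at every rate below `γ`.

The estimator equations are solved in closed form. The matrix
`M = P Q P + α e^{-βt} P + κ (1 - P)` satisfies `M' = -β M + R`, and it is positive definite because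
`0 ≤ P ≤ 1`. Its inverse therefore solves the Riccati equation, which gives existence, and
`1 - Ω M` solves a homogeneous linear equation with zero initial value, so `Ω = M⁻¹` for every run
(`EstimatorRun.Ω_mul_gainInv`). Likewise `M θd = P ϕ`, since both sides solve the same linear
equation. The least squares solution `θ*`, on the other hand, is characterized by the normal
equations `(Q + α e^{-βt}) θ* = ϕ` (`FilterRun.isLeastSquares_iff`), and `S θ* = S θ₀` because the
data carry no information on `U`.

Combining these, `M (θhat - θ*)` is linear in `P - (1 - S)` with bounded coefficients
(`EstimatorRun.gainInv_mulVec_error`). Since `M` is uniformly coercive for large times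
(`FilterRun.exists_gainInv_coercive`) and `θ*` is bounded, the error decays as fast as
`P - (1 - S)`. Without noise `ϕ = Q θ + α e^{-βt} θ₀`, so that `(1 - S) (θ* - θ)` decays like
`e^{-βt}` (`FilterRun.exists_noise_free_decay`), and the last claim follows.

Matrices carry the operator norm of the supremum norm on `Fin n → ℝ`, which makes them a Banach
algebra; `eucl` is compared with the supremum norm only where it enters or leaves an estimate.
-/

open Filter Topology MeasureTheory
open scoped Matrix.Norms.Operator

namespace ParamLearning

/-! ### Scalar linear differential equations on the half line -/

theorem hasDerivWithinAt_exp_mul {x : ℝ → ℝ} {b g t : ℝ} {s : Set ℝ}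
    (h : HasDerivWithinAt x (-b * x t + g) s t) :
    HasDerivWithinAt (fun u => Real.exp (b * u) * x u) (Real.exp (b * t) * g) s t := by
  have h1 : HasDerivWithinAt (fun u : ℝ => Real.exp (b * u)) (Real.exp (b * t) * b) s t := by
    simpa using (((hasDerivAt_id t).const_mul b).exp).hasDerivWithinAt
  exact (h1.mul h).congr_deriv (by ring)

theorem exp_mul_monotoneOn {x g : ℝ → ℝ} {b : ℝ}
    (h : ∀ t, 0 ≤ t → HasDerivWithinAt x (-b * x t + g t) (Ici 0) t)
    (hg : ∀ t, 0 ≤ t → 0 ≤ g t) :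
    MonotoneOn (fun u => Real.exp (b * u) * x u) (Ici 0) := by
  refine monotoneOn_of_hasDerivWithinAt_nonneg (f' := fun t => Real.exp (b * t) * g t)
    (convex_Ici 0) (fun t ht => (hasDerivWithinAt_exp_mul (h t ht)).continuousWithinAt)
    (fun t ht => ?_) (fun t ht => ?_)
  · exact (hasDerivWithinAt_exp_mul (h t (interior_subset ht))).mono interior_subset
  · exact mul_nonneg (Real.exp_pos _).le (hg t (interior_subset ht))

/-- Comparison principle: a scalar linear equation with nonnegative forcing and initial value has
a nonnegative solution. -/
theorem nonneg_of_linear_ode {x g : ℝ → ℝ} {b : ℝ}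
    (h : ∀ t, 0 ≤ t → HasDerivWithinAt x (-b * x t + g t) (Ici 0) t)
    (hg : ∀ t, 0 ≤ t → 0 ≤ g t) (h0 : 0 ≤ x 0) {t : ℝ} (ht : 0 ≤ t) : 0 ≤ x t := by
  have := exp_mul_monotoneOn h hg (mem_Ici.2 le_rfl) (mem_Ici.2 ht) ht
  simp only [mul_zero, Real.exp_zero, one_mul] at this
  exact nonneg_of_mul_nonneg_right (h0.trans this) (Real.exp_pos _)

theorem le_of_linear_ode {x y f g : ℝ → ℝ} {b : ℝ}
    (hx : ∀ t, 0 ≤ t → HasDerivWithinAt x (-b * x t + f t) (Ici 0) t)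
    (hy : ∀ t, 0 ≤ t → HasDerivWithinAt y (-b * y t + g t) (Ici 0) t)
    (hfg : ∀ t, 0 ≤ t → f t ≤ g t) (h0 : x 0 ≤ y 0) {t : ℝ} (ht : 0 ≤ t) : x t ≤ y t := by
  have := nonneg_of_linear_ode (x := fun t => y t - x t) (g := fun t => g t - f t) (b := b)
    (fun t ht => ((hy t ht).sub (hx t ht)).congr_deriv (by ring))
    (fun t ht => sub_nonneg.2 (hfg t ht)) (sub_nonneg.2 h0) ht
  exact sub_nonneg.1 this

theorem eq_of_linear_ode {x y g : ℝ → ℝ} {b : ℝ}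
    (hx : ∀ t, 0 ≤ t → HasDerivWithinAt x (-b * x t + g t) (Ici 0) t)
    (hy : ∀ t, 0 ≤ t → HasDerivWithinAt y (-b * y t + g t) (Ici 0) t)
    (h0 : x 0 = y 0) {t : ℝ} (ht : 0 ≤ t) : x t = y t :=
  le_antisymm (le_of_linear_ode hx hy (fun _ _ => le_rfl) h0.le ht)
    (le_of_linear_ode hy hx (fun _ _ => le_rfl) h0.ge ht)

/-- A stable scalar linear equation with bounded forcing has a bounded solution: `C / b` is the
equilibrium for the constant forcing `C`. -/
theorem le_bound_of_linear_ode {x g : ℝ → ℝ} {b C : ℝ} (hb : 0 < b)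
    (hx : ∀ t, 0 ≤ t → HasDerivWithinAt x (-b * x t + g t) (Ici 0) t)
    (hg : ∀ t, 0 ≤ t → g t ≤ C) {t : ℝ} (ht : 0 ≤ t) : x t ≤ max (x 0) (C / b) := by
  refine le_of_linear_ode (y := fun _ => max (x 0) (C / b))
    (g := fun _ => b * max (x 0) (C / b)) hx
    (fun t _ => (hasDerivWithinAt_const _ _ _).congr_deriv (by ring)) (fun t ht => ?_)
    (le_max_left _ _) ht
  calc g t ≤ C := hg t ht
    _ = b * (C / b) := by field_simp
    _ ≤ _ := by gcongr; exact le_max_right _ _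

theorem abs_bound_of_linear_ode {x g : ℝ → ℝ} {b C : ℝ} (hb : 0 < b)
    (hx : ∀ t, 0 ≤ t → HasDerivWithinAt x (-b * x t + g t) (Ici 0) t)
    (hg : ∀ t, 0 ≤ t → |g t| ≤ C) {t : ℝ} (ht : 0 ≤ t) : |x t| ≤ max |x 0| (C / b) := by
  refine abs_le'.2 ⟨?_, ?_⟩
  · exact (le_bound_of_linear_ode hb hx (fun t ht => (le_abs_self _).trans (hg t ht)) ht).trans
      (max_le_max_right _ (le_abs_self _))
  · exact (le_bound_of_linear_ode (x := fun t => - x t) (g := fun t => - g t) hb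
      (fun t ht => (hx t ht).neg.congr_deriv (by ring))
      (fun t ht => (neg_le_abs _).trans (hg t ht)) ht).trans
      (max_le_max_right _ (neg_le_abs _))

/-- Fundamental theorem of calculus on `[0, ∞)`, one-sided at `0`. -/
theorem hasDerivWithinAt_primitive {g : ℝ → ℝ} (hg : ContinuousOn g (Ici 0)) {t : ℝ}
    (ht : 0 ≤ t) : HasDerivWithinAt (fun u => ∫ τ in (0 : ℝ)..u, g τ) (g t) (Ici 0) t := by
  have hc : Continuous fun u : ℝ => g (max u 0) :=
    hg.comp_continuous (continuous_id.max continuous_const) (fun u => mem_Ici.2 (le_max_right u 0))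
  have h1 := (intervalIntegral.integral_hasDerivAt_right (hc.intervalIntegrable 0 t)
    (hc.stronglyMeasurableAtFilter _ _) hc.continuousAt).hasDerivWithinAt (s := Ici 0)
  rw [max_eq_left ht] at h1
  have key : ∀ u ∈ Ici (0 : ℝ), (∫ τ in (0 : ℝ)..u, g τ) = ∫ τ in (0 : ℝ)..u, g (max τ 0) := by
    intro u hu
    refine intervalIntegral.integral_congr (fun τ hτ => ?_)
    rw [uIcc_of_le hu] at hτ
    simp [max_eq_left hτ.1]
  exact h1.congr key (key t ht)

theorem discounted_eq (b t : ℝ) (g : ℝ → ℝ) :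
    ∫ τ in (0 : ℝ)..t, Real.exp (-b * (t - τ)) * g τ
      = Real.exp (-b * t) * ∫ τ in (0 : ℝ)..t, Real.exp (b * τ) * g τ := by
  rw [← intervalIntegral.integral_const_mul]
  refine intervalIntegral.integral_congr (fun τ _ => ?_)
  simp only [← mul_assoc, ← Real.exp_add]
  ring_nf

/-- Variation of constants: exponential filtering of a continuous signal solves the scalar linear
equation. -/
theorem hasDerivWithinAt_discounted {g : ℝ → ℝ} {b : ℝ} (x₀ : ℝ) (hg : ContinuousOn g (Ici 0))
    {t : ℝ} (ht : 0 ≤ t) :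
    HasDerivWithinAt
      (fun t => Real.exp (-b * t) * x₀ + ∫ τ in (0 : ℝ)..t, Real.exp (-b * (t - τ)) * g τ)
      (-b * (Real.exp (-b * t) * x₀ + ∫ τ in (0 : ℝ)..t, Real.exp (-b * (t - τ)) * g τ) + g t)
      (Ici 0) t := by
  simp only [discounted_eq]
  have h1 : HasDerivWithinAt (fun u : ℝ => Real.exp (-b * u)) (Real.exp (-b * t) * (-b))
      (Ici 0) t := by
    simpa using (((hasDerivAt_id t).const_mul (-b)).exp).hasDerivWithinAt
  have h2 := hasDerivWithinAt_primitive (g := fun τ => Real.exp (b * τ) * g τ)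
    (by fun_prop) ht
  refine ((h1.mul_const x₀).add (h1.mul h2)).congr_deriv ?_
  have : Real.exp (-b * t) * (Real.exp (b * t) * g t) = g t := by
    rw [← mul_assoc, ← Real.exp_add]; simp
  rw [this]; ring

theorem exists_linear_ode {g : ℝ → ℝ} (b x₀ : ℝ) (hg : ContinuousOn g (Ici 0)) :
    ∃ x : ℝ → ℝ, x 0 = x₀ ∧ ∀ t, 0 ≤ t → HasDerivWithinAt x (-b * x t + g t) (Ici 0) t :=
  ⟨_, by simp, fun _ ht => hasDerivWithinAt_discounted x₀ hg ht⟩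

theorem discounted_solves {g : ℝ → ℝ} {b : ℝ} (hg : ContinuousOn g (Ici 0)) {t : ℝ} (ht : 0 ≤ t) :
    HasDerivWithinAt (fun t => ∫ τ in (0 : ℝ)..t, Real.exp (-b * (t - τ)) * g τ)
      (-b * (∫ τ in (0 : ℝ)..t, Real.exp (-b * (t - τ)) * g τ) + g t) (Ici 0) t := by
  simpa using hasDerivWithinAt_discounted (b := b) 0 hg ht

/-- If a nonnegative signal drives the filter, the filter state dominates the discounted
integral of the signal over any past window. -/
theorem exp_mul_integral_le {x g : ℝ → ℝ} {b : ℝ} (hb : 0 ≤ b)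
    (hx : ∀ t, 0 ≤ t → HasDerivWithinAt x (-b * x t + g t) (Ici 0) t) (h0 : 0 ≤ x 0)
    (hgc : ContinuousOn g (Ici 0)) (hg : ∀ t, 0 ≤ t → 0 ≤ g t) {s T : ℝ} (hs : 0 ≤ s)
    (hT : 0 ≤ T) : Real.exp (-b * T) * ∫ τ in s..(s + T), g τ ≤ x (s + T) := by
  have hsub : Icc s (s + T) ⊆ Ici 0 := fun u hu => hs.trans hu.1
  have hmono : MonotoneOn (fun u => Real.exp (b * u) * x u
      - Real.exp (b * s) * ∫ τ in (0 : ℝ)..u, g τ) (Icc s (s + T)) := by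
    refine monotoneOn_of_hasDerivWithinAt_nonneg
      (f' := fun t => Real.exp (b * t) * g t - Real.exp (b * s) * g t) (convex_Icc _ _) ?_ ?_ ?_
    · intro t ht
      exact (((hasDerivWithinAt_exp_mul (hx t (hsub ht))).sub
        ((hasDerivWithinAt_primitive hgc (hsub ht)).const_mul _)).mono hsub).continuousWithinAt
    · intro t ht
      exact ((hasDerivWithinAt_exp_mul (hx t (hsub (interior_subset ht)))).sub
        ((hasDerivWithinAt_primitive hgc (hsub (interior_subset ht))).const_mul _)).mono
          (interior_subset.trans hsub)
    · intro t ht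
      have ht' := interior_subset ht
      rw [← sub_mul]
      refine mul_nonneg (sub_nonneg.2 (Real.exp_le_exp.2 ?_)) (hg t (hsub ht'))
      exact mul_le_mul_of_nonneg_left ht'.1 hb
  have h := hmono (left_mem_Icc.2 (by linarith)) (right_mem_Icc.2 (by linarith)) (by linarith)
  simp only at h
  have hii : ∀ u, 0 ≤ u → IntervalIntegrable g volume 0 u := fun u hu =>
    (hgc.mono (by rw [uIcc_of_le hu]; exact Icc_subset_Ici_self)).intervalIntegrable
  have hsplit := intervalIntegral.integral_interval_sub_left (hii (s + T) (by linarith)) (hii s hs)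
  have hxs := nonneg_of_linear_ode hx hg h0 hs
  have h2 : Real.exp (b * s) * ∫ τ in s..(s + T), g τ ≤ Real.exp (b * (s + T)) * x (s + T) := by
    rw [← hsplit, mul_sub]
    have := mul_nonneg (Real.exp_pos (b * s)).le hxs
    linarith
  have h3 := mul_le_mul_of_nonneg_left h2 (Real.exp_pos (-b * (s + T))).le
  rw [← mul_assoc, ← mul_assoc, ← Real.exp_add, ← Real.exp_add] at h3
  rw [show -b * (s + T) + b * s = -b * T by ring,
    show -b * (s + T) + b * (s + T) = 0 by ring, Real.exp_zero, one_mul] at h3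
  exact h3

theorem hasDerivWithinAt_decay (α β t : ℝ) :
    HasDerivWithinAt (fun u : ℝ => α * Real.exp (-β * u)) (-β * (α * Real.exp (-β * t)))
      (Ici 0) t := by
  have h : HasDerivWithinAt (fun u : ℝ => Real.exp (-β * u)) (Real.exp (-β * t) * (-β))
      (Ici 0) t := by
    simpa using (((hasDerivAt_id t).const_mul (-β)).exp).hasDerivWithinAt
  exact (h.const_mul α).congr_deriv (by ring)

/-! ### Euclidean norm and coercive matrices -/

variable {n : ℕ} {α β γ δ κ : ℝ} {θ₀ : Fin n → ℝ} {φ : ℝ → Fin n → ℝ} {z : ℝ → ℝ}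

theorem eucl_sq (v : Fin n → ℝ) : eucl v ^ 2 = v ⬝ᵥ v := by
  simp [eucl, EuclideanSpace.norm_sq_eq, dotProduct, ← pow_two]

theorem eucl_nonneg (v : Fin n → ℝ) : 0 ≤ eucl v := norm_nonneg _

theorem eucl_add_le (v w : Fin n → ℝ) : eucl (v + w) ≤ eucl v + eucl w := by
  unfold eucl; rw [WithLp.toLp_add]; exact norm_add_le _ _

theorem abs_dotProduct_le (v w : Fin n → ℝ) : |v ⬝ᵥ w| ≤ eucl v * eucl w := by
  have := abs_real_inner_le_norm (WithLp.toLp 2 w : EuclideanSpace ℝ (Fin n)) (WithLp.toLp 2 v)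
  rw [mul_comm]
  simpa [eucl, EuclideanSpace.inner_toLp_toLp] using this

theorem abs_apply_le_eucl (v : Fin n → ℝ) (i : Fin n) : |v i| ≤ eucl v :=
  PiLp.norm_apply_le (WithLp.toLp 2 v : EuclideanSpace ℝ (Fin n)) i

theorem norm_le_eucl (v : Fin n → ℝ) : ‖v‖ ≤ eucl v :=
  (pi_norm_le_iff_of_nonneg (eucl_nonneg v)).2 (abs_apply_le_eucl v)

theorem eucl_le_norm (v : Fin n → ℝ) : eucl v ≤ Real.sqrt n * ‖v‖ := by
  unfold eucl
  rw [EuclideanSpace.norm_eq]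
  calc Real.sqrt (∑ i, ‖v i‖ ^ 2) ≤ Real.sqrt (∑ _i : Fin n, ‖v‖ ^ 2) := by
        gcongr with i; exact norm_le_pi_norm v i
    _ = Real.sqrt n * ‖v‖ := by simp [Real.sqrt_mul, Real.sqrt_sq (norm_nonneg v)]

/-- A lower bound on the quadratic form bounds the solution of a linear system by its right-hand
side. -/
theorem eucl_le_of_coercive {S : Matrix (Fin n) (Fin n) ℝ} {c : ℝ} {v : Fin n → ℝ} (hc : 0 < c)
    (h : c * (v ⬝ᵥ v) ≤ v ⬝ᵥ (S *ᵥ v)) : eucl v ≤ eucl (S *ᵥ v) / c := by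
  rw [le_div_iff₀ hc]
  rcases (eucl_nonneg v).eq_or_lt with h0 | h0
  · rw [← h0, zero_mul]; exact eucl_nonneg _
  · refine le_of_mul_le_mul_left ?_ h0
    have := (le_abs_self _).trans (abs_dotProduct_le v (S *ᵥ v))
    rw [← eucl_sq] at h
    nlinarith

/-- A positive definite matrix is uniformly coercive. -/
theorem exists_coercive {S : Matrix (Fin n) (Fin n) ℝ}
    (h : ∀ v : Fin n → ℝ, v ≠ 0 → 0 < v ⬝ᵥ (S *ᵥ v)) :
    ∃ c : ℝ, 0 < c ∧ ∀ v : Fin n → ℝ, c * (v ⬝ᵥ v) ≤ v ⬝ᵥ (S *ᵥ v) := by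
  have hcont : Continuous fun v : Fin n → ℝ => v ⬝ᵥ (S *ᵥ v) := by fun_prop
  rcases (Metric.sphere (0 : Fin n → ℝ) 1).eq_empty_or_nonempty with he | hne
  · refine ⟨1, one_pos, fun v => ?_⟩
    by_cases hv : v = 0
    · simp [hv]
    · have : (‖v‖⁻¹ • v) ∈ Metric.sphere (0 : Fin n → ℝ) 1 := by
        simp [norm_smul, norm_ne_zero_iff.2 hv]
      rw [he] at this; exact this.elim
  · obtain ⟨w, hw, hmin⟩ := (isCompact_sphere (0 : Fin n → ℝ) 1).exists_isMinOn hne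
      hcont.continuousOn
    have hw0 : w ≠ 0 := by
      rintro rfl; simp at hw
    have hm := h w hw0
    set m := w ⬝ᵥ (S *ᵥ w)
    refine ⟨m / (n + 1), by positivity, fun v => ?_⟩
    by_cases hv : v = 0
    · simp [hv]
    have hv0 : 0 < ‖v‖ := norm_pos_iff.2 hv
    have hmem : (‖v‖⁻¹ • v) ∈ Metric.sphere (0 : Fin n → ℝ) 1 := by
      simp [norm_smul, norm_ne_zero_iff.2 hv]
    have h1 : m ≤ ‖v‖⁻¹ * (‖v‖⁻¹ * (v ⬝ᵥ (S *ᵥ v))) := by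
      simpa [Matrix.mulVec_smul] using hmin hmem
    have h2 : m * ‖v‖ ^ 2 ≤ v ⬝ᵥ (S *ᵥ v) := by
      calc m * ‖v‖ ^ 2 ≤ ‖v‖⁻¹ * (‖v‖⁻¹ * (v ⬝ᵥ (S *ᵥ v))) * ‖v‖ ^ 2 := by gcongr
        _ = _ := by field_simp
    have h3 : v ⬝ᵥ v ≤ n * ‖v‖ ^ 2 := by
      rw [← eucl_sq]
      calc eucl v ^ 2 ≤ (Real.sqrt n * ‖v‖) ^ 2 := by
            gcongr; exacts [eucl_nonneg v, eucl_le_norm v]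
        _ = _ := by rw [mul_pow, Real.sq_sqrt (Nat.cast_nonneg n)]
    calc m / (n + 1) * (v ⬝ᵥ v) ≤ m / (n + 1) * ((n + 1) * ‖v‖ ^ 2) := by
          gcongr; nlinarith [sq_nonneg ‖v‖]
      _ = m * ‖v‖ ^ 2 := by field_simp
      _ ≤ _ := h2

/-! ### Orthogonal projectors -/

theorem IsOrthonormalBasisOf.mulVec_of_mem {m : ℕ} {N : Matrix (Fin n) (Fin m) ℝ}
    {S : Submodule ℝ (Fin n → ℝ)} (h : IsOrthonormalBasisOf N S) {v : Fin n → ℝ} (hv : v ∈ S) :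
    (N * Nᵀ) *ᵥ v = v := by
  rw [← h.2] at hv
  obtain ⟨w, rfl⟩ := hv
  simp only [Matrix.mulVecLin_apply, Matrix.mulVec_mulVec]
  rw [Matrix.mul_assoc, h.1, Matrix.mul_one]

theorem IsOrthonormalBasisOf.mulVec_mem {m : ℕ} {N : Matrix (Fin n) (Fin m) ℝ}
    {S : Submodule ℝ (Fin n → ℝ)} (h : IsOrthonormalBasisOf N S) (v : Fin n → ℝ) :
    (N * Nᵀ) *ᵥ v ∈ S := by
  rw [← h.2, ← Matrix.mulVec_mulVec]
  exact ⟨_, rfl⟩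

theorem IsOrthonormalBasisOf.mul_self {m : ℕ} {N : Matrix (Fin n) (Fin m) ℝ}
    {S : Submodule ℝ (Fin n → ℝ)} (h : IsOrthonormalBasisOf N S) :
    (N * Nᵀ) * (N * Nᵀ) = N * Nᵀ := by
  rw [Matrix.mul_assoc, ← Matrix.mul_assoc Nᵀ, h.1, Matrix.one_mul]

theorem transpose_mul_transpose_self {m : ℕ} (N : Matrix (Fin n) (Fin m) ℝ) :
    (N * Nᵀ)ᵀ = N * Nᵀ := by simp

/-- The orthogonal projector onto a subspace does not depend on the orthonormal basis. -/
theorem IsOrthonormalBasisOf.projector_unique {m m' : ℕ} {N : Matrix (Fin n) (Fin m) ℝ}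
    {N' : Matrix (Fin n) (Fin m') ℝ} {S : Submodule ℝ (Fin n → ℝ)}
    (h : IsOrthonormalBasisOf N S) (h' : IsOrthonormalBasisOf N' S) : N * Nᵀ = N' * N'ᵀ := by
  have h1 : (N * Nᵀ) * (N' * N'ᵀ) = N' * N'ᵀ := by
    refine Matrix.ext_of_mulVec_single fun i => ?_
    rw [← Matrix.mulVec_mulVec]
    exact h.mulVec_of_mem (h'.mulVec_mem _)
  have h2 : (N' * N'ᵀ) * (N * Nᵀ) = N * Nᵀ := by
    refine Matrix.ext_of_mulVec_single fun i => ?_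
    rw [← Matrix.mulVec_mulVec]
    exact h'.mulVec_of_mem (h.mulVec_mem _)
  have := congrArg Matrix.transpose h1
  rw [Matrix.transpose_mul, transpose_mul_transpose_self, transpose_mul_transpose_self, h2] at this
  exact this

theorem dotProduct_projector {m : ℕ} (N : Matrix (Fin n) (Fin m) ℝ) (v : Fin n → ℝ) :
    v ⬝ᵥ ((N * Nᵀ) *ᵥ v) = (Nᵀ *ᵥ v) ⬝ᵥ (Nᵀ *ᵥ v) := by
  rw [← Matrix.mulVec_mulVec, Matrix.dotProduct_mulVec, ← Matrix.mulVec_transpose]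

theorem dotProduct_projector_nonneg {m : ℕ} (N : Matrix (Fin n) (Fin m) ℝ) (v : Fin n → ℝ) :
    0 ≤ v ⬝ᵥ ((N * Nᵀ) *ᵥ v) := by
  rw [dotProduct_projector]; exact Finset.sum_nonneg fun _ _ => mul_self_nonneg _

theorem dotProduct_mulVec_comm {S : Matrix (Fin n) (Fin n) ℝ} (hS : Sᵀ = S) (v w : Fin n → ℝ) :
    v ⬝ᵥ (S *ᵥ w) = (S *ᵥ v) ⬝ᵥ w := by
  rw [Matrix.dotProduct_mulVec, ← Matrix.mulVec_transpose, hS]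

theorem real_dotProduct_self_nonneg (v : Fin n → ℝ) : 0 ≤ v ⬝ᵥ v :=
  Finset.sum_nonneg fun _ _ => mul_self_nonneg _

theorem IsOrthonormalBasisOf.dotProduct_projector_le {m : ℕ} {N : Matrix (Fin n) (Fin m) ℝ}
    {S : Submodule ℝ (Fin n → ℝ)} (h : IsOrthonormalBasisOf N S) (v : Fin n → ℝ) :
    v ⬝ᵥ ((N * Nᵀ) *ᵥ v) ≤ v ⬝ᵥ v := by
  have h1 := real_dotProduct_self_nonneg (v - (N * Nᵀ) *ᵥ v)
  have h2 : ((N * Nᵀ) *ᵥ v) ⬝ᵥ ((N * Nᵀ) *ᵥ v) = v ⬝ᵥ ((N * Nᵀ) *ᵥ v) := by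
    rw [← dotProduct_mulVec_comm (transpose_mul_transpose_self N), Matrix.mulVec_mulVec, h.mul_self]
  rw [sub_dotProduct, dotProduct_sub, dotProduct_sub, h2, dotProduct_comm ((N * Nᵀ) *ᵥ v) v] at h1
  linarith

theorem exists_isOrthonormalBasisOf (S : Submodule ℝ (Fin n → ℝ)) :
    ∃ (m : ℕ) (N : Matrix (Fin n) (Fin m) ℝ), IsOrthonormalBasisOf N S := by
  let e := (WithLp.linearEquiv 2 ℝ (Fin n → ℝ))
  let S' : Submodule ℝ (EuclideanSpace ℝ (Fin n)) := S.map e.symm.toLinearMap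
  let b := stdOrthonormalBasis ℝ S'
  refine ⟨_, Matrix.of fun i j => (b j : EuclideanSpace ℝ (Fin n)) i, ?_, ?_⟩
  · ext i j
    have := b.inner_eq_ite i j
    rw [Matrix.mul_apply, Matrix.one_apply, ← this, Submodule.coe_inner, PiLp.inner_apply]
    exact Finset.sum_congr rfl fun k _ => mul_comm _ _
  · rw [Matrix.range_mulVecLin]
    have h1 : Submodule.span ℝ (Set.range fun j => ((b j : S') : EuclideanSpace ℝ (Fin n)))
        = S' := by
      have := congrArg (Submodule.map S'.subtype) b.toBasis.span_eq
      rw [Submodule.map_span, ← Set.range_comp] at this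
      simpa [Function.comp_def] using this
    have h2 := congrArg (Submodule.map e.toLinearMap) h1
    rw [Submodule.map_span, ← Set.range_comp] at h2
    have h3 : S'.map e.toLinearMap = S := by
      simp only [S', ← Submodule.map_comp]
      simp
    rw [h3] at h2
    exact h2

/-! ### Calculus of matrix signals -/

theorem hasMatrixDerivAt_iff {X : ℝ → Matrix (Fin n) (Fin n) ℝ} {X' : Matrix (Fin n) (Fin n) ℝ}
    {t : ℝ} : HasMatrixDerivAt X X' t ↔ HasDerivWithinAt X X' (Ici 0) t := by
  unfold HasMatrixDerivAt
  exact (hasDerivWithinAt_pi.trans (forall_congr' fun i => hasDerivWithinAt_pi)).symm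

theorem HasMatrixDerivAt.mulVec {X : ℝ → Matrix (Fin n) (Fin n) ℝ}
    {X' : Matrix (Fin n) (Fin n) ℝ} {v : ℝ → Fin n → ℝ} {v' : Fin n → ℝ} {t : ℝ}
    (hX : HasMatrixDerivAt X X' t) (hv : HasDerivWithinAt v v' (Ici 0) t) :
    HasDerivWithinAt (fun s => X s *ᵥ v s) (X' *ᵥ v t + X t *ᵥ v') (Ici 0) t := by
  rw [hasDerivWithinAt_pi] at hv ⊢
  intro i
  simp only [Matrix.mulVec, dotProduct, Pi.add_apply, ← Finset.sum_add_distrib]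
  exact HasDerivWithinAt.fun_sum fun j _ => (hX i j).mul (hv j)

theorem hasDerivWithinAt_dotProduct {v : ℝ → Fin n → ℝ} {v' : Fin n → ℝ} {t : ℝ} {s : Set ℝ}
    (hv : HasDerivWithinAt v v' s t) (w : Fin n → ℝ) :
    HasDerivWithinAt (fun s => w ⬝ᵥ v s) (w ⬝ᵥ v') s t := by
  rw [hasDerivWithinAt_pi] at hv
  exact HasDerivWithinAt.fun_sum fun j _ => (hv j).const_mul (w j)

theorem HasMatrixDerivAt.mul {X Y : ℝ → Matrix (Fin n) (Fin n) ℝ}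
    {X' Y' : Matrix (Fin n) (Fin n) ℝ} {t : ℝ}
    (hX : HasMatrixDerivAt X X' t) (hY : HasMatrixDerivAt Y Y' t) :
    HasMatrixDerivAt (fun s => X s * Y s) (X' * Y t + X t * Y') t := by
  rw [hasMatrixDerivAt_iff] at *
  exact hX.mul hY

theorem HasMatrixDerivAt.inv {X : ℝ → Matrix (Fin n) (Fin n) ℝ}
    {X' : Matrix (Fin n) (Fin n) ℝ} {t : ℝ}
    (hX : HasMatrixDerivAt X X' t) (hu : IsUnit (X t)) :
    HasMatrixDerivAt (fun s => (X s)⁻¹) (-((X t)⁻¹ * X' * (X t)⁻¹)) t := by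
  rw [hasMatrixDerivAt_iff] at *
  obtain ⟨u, hu⟩ := hu
  have h := hasFDerivAt_ringInverse (𝕜 := ℝ) u
  rw [hu] at h
  have h2 := h.comp_hasDerivWithinAt t hX
  simp only [Function.comp_def, ← Matrix.nonsing_inv_eq_ringInverse] at h2
  refine h2.congr_deriv ?_
  simp [← hu, Matrix.coe_units_inv]

/-- A matrix solution of a homogeneous linear equation with continuous coefficients that starts
at zero vanishes. -/
theorem eq_zero_of_homogeneous {X K : ℝ → Matrix (Fin n) (Fin n) ℝ}
    (hX : ∀ t, 0 ≤ t → HasMatrixDerivAt X (K t * X t) t) (hK : ContinuousOn K (Ici 0))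
    (h0 : X 0 = 0) {t : ℝ} (ht : 0 ≤ t) : X t = 0 := by
  obtain ⟨C, hC⟩ := (isCompact_Icc (a := (0 : ℝ)) (b := t)).exists_bound_of_continuousOn
    (hK.mono Icc_subset_Ici_self)
  refine eq_zero_of_abs_deriv_le_mul_abs_self_of_eq_zero_right (f := X) (f' := fun t => K t * X t)
    (K := C) (a := 0) (b := t) ?_ ?_ h0 ?_ t (right_mem_Icc.2 ht)
  · exact fun s hs => ((hasMatrixDerivAt_iff.1 (hX s hs.1)).continuousWithinAt).mono
      Icc_subset_Ici_self
  · exact fun s hs => (hasMatrixDerivAt_iff.1 (hX s hs.1)).mono (Ici_subset_Ici.2 hs.1)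
  · intro s hs
    exact (norm_mul_le _ _).trans
      (mul_le_mul_of_nonneg_right (hC s (Ico_subset_Icc_self hs)) (norm_nonneg _))

theorem norm_le_sum_entries (A : Matrix (Fin n) (Fin n) ℝ) : ‖A‖ ≤ ∑ i, ∑ j, |A i j| := by
  have hnn : 0 ≤ ∑ i, ∑ j, |A i j| :=
    Finset.sum_nonneg fun _ _ => Finset.sum_nonneg fun _ _ => abs_nonneg _
  rw [Matrix.linfty_opNorm_def, ← Real.le_toNNReal_iff_coe_le hnn]
  refine Finset.sup_le fun i _ => ?_
  rw [Real.le_toNNReal_iff_coe_le hnn]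
  push_cast
  exact Finset.single_le_sum (f := fun i => ∑ j, |A i j|)
    (fun _ _ => Finset.sum_nonneg fun _ _ => abs_nonneg _) (Finset.mem_univ i)

/-- Entrywise bounds by multiples of a common function give a norm bound by a multiple of it. -/
theorem exists_norm_le_of_entries {X : ℝ → Matrix (Fin n) (Fin n) ℝ} {s : Set ℝ} {g : ℝ → ℝ}
    (h : ∀ i j, ∃ C, ∀ t ∈ s, |X t i j| ≤ C * g t) : ∃ C, ∀ t ∈ s, ‖X t‖ ≤ C * g t := by
  choose C hC using h
  refine ⟨∑ i, ∑ j, C i j, fun t ht => (norm_le_sum_entries _).trans ?_⟩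
  simp only [Finset.sum_mul]
  exact Finset.sum_le_sum fun i _ => Finset.sum_le_sum fun j _ => hC i j t ht

theorem intervalIntegrable_row {A : ℝ → Matrix (Fin n) (Fin n) ℝ} {a b : ℝ}
    (hA : ∀ i j, IntervalIntegrable (fun τ => A τ i j) volume a b) (w : Fin n → ℝ) (i : Fin n) :
    IntervalIntegrable (fun τ => ∑ j, A τ i j * w j) volume a b := by
  simpa only [Finset.sum_fn] using IntervalIntegrable.sum Finset.univ fun j _ =>
    (hA i j).mul_const (w j)

/-- Integrals commute with bilinear forms of matrix signals. -/
theorem dotProduct_integral_mulVec {A : ℝ → Matrix (Fin n) (Fin n) ℝ} {a b : ℝ}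
    (hA : ∀ i j, IntervalIntegrable (fun τ => A τ i j) volume a b) (v w : Fin n → ℝ) :
    v ⬝ᵥ ((Matrix.of fun i j => ∫ τ in a..b, A τ i j) *ᵥ w) = ∫ τ in a..b, v ⬝ᵥ (A τ *ᵥ w) := by
  simp only [dotProduct, Matrix.mulVec, Matrix.of_apply]
  rw [intervalIntegral.integral_finsetSum fun i _ =>
    (intervalIntegrable_row hA w i).const_mul (v i)]
  refine Finset.sum_congr rfl fun i _ => ?_
  rw [intervalIntegral.integral_const_mul,
    intervalIntegral.integral_finsetSum fun j _ => (hA i j).mul_const (w j)]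
  simp only [intervalIntegral.integral_mul_const]

theorem intervalIntegrable_bilin {A : ℝ → Matrix (Fin n) (Fin n) ℝ} {a b : ℝ}
    (hA : ∀ i j, IntervalIntegrable (fun τ => A τ i j) volume a b) (v w : Fin n → ℝ) :
    IntervalIntegrable (fun τ => v ⬝ᵥ (A τ *ᵥ w)) volume a b := by
  simp only [dotProduct, Matrix.mulVec]
  simpa only [Finset.sum_fn] using IntervalIntegrable.sum Finset.univ fun i _ =>
    (intervalIntegrable_row hA w i).const_mul (v i)

theorem dotProduct_vecMulVec_mulVec (v w : Fin n → ℝ) :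
    v ⬝ᵥ (Matrix.vecMulVec w w *ᵥ v) = (v ⬝ᵥ w) ^ 2 := by
  rw [Matrix.vecMulVec_mulVec, dotProduct_smul, dotProduct_comm w v]
  simp [pow_two]

theorem posSemidef_dotProduct_nonneg {S : Matrix (Fin n) (Fin n) ℝ} (h : S.PosSemidef)
    (v : Fin n → ℝ) : 0 ≤ v ⬝ᵥ (S *ᵥ v) := by
  simpa using h.dotProduct_mulVec_nonneg v

theorem posSemidef_mulVec_eq_zero {S : Matrix (Fin n) (Fin n) ℝ} (h : S.PosSemidef)
    {v : Fin n → ℝ} (hv : v ⬝ᵥ (S *ᵥ v) ≤ 0) : S *ᵥ v = 0 := by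
  refine (h.dotProduct_mulVec_zero_iff v).1 ?_
  simpa using le_antisymm hv (posSemidef_dotProduct_nonneg h v)

/-! ### Unexcited directions -/

/-- The directions in which the regressor is never excited. -/
def unexcited (φ : ℝ → Fin n → ℝ) : Submodule ℝ (Fin n → ℝ) where
  carrier := {v | ∀ t : ℝ, 0 ≤ t → v ⬝ᵥ φ t = 0}
  zero_mem' := fun t _ => zero_dotProduct _
  add_mem' := fun ha hb t ht => by rw [add_dotProduct, ha t ht, hb t ht, add_zero]
  smul_mem' := fun c v hv t ht => by rw [smul_dotProduct, hv t ht, smul_zero]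

section excitation

variable {φ : ℝ → Fin n → ℝ} (hφ : ContinuousOn φ (Ici 0))
include hφ

theorem continuousOn_apply (i : Fin n) : ContinuousOn (fun t => φ t i) (Ici 0) :=
  continuousOn_pi.1 hφ i

theorem continuousOn_dotProduct (v : Fin n → ℝ) : ContinuousOn (fun t => v ⬝ᵥ φ t) (Ici 0) := by
  simp only [dotProduct]
  exact continuousOn_finsetSum _ fun i _ => continuousOn_const.mul (continuousOn_apply hφ i)

theorem dotProduct_excitation {T t : ℝ} (hT : 0 ≤ T) (ht : 0 ≤ t) (v : Fin n → ℝ) :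
    v ⬝ᵥ (excitation φ T t *ᵥ v) = ∫ τ in t..(t + T), (v ⬝ᵥ φ τ) ^ 2 := by
  have hsub : uIcc t (t + T) ⊆ Ici 0 := by
    rw [uIcc_of_le (by linarith)]; exact fun u hu => ht.trans hu.1
  have := dotProduct_integral_mulVec (A := fun τ => Matrix.vecMulVec (φ τ) (φ τ)) (a := t)
    (b := t + T) (fun i j => (((continuousOn_apply hφ i).mul
      (continuousOn_apply hφ j)).mono hsub).intervalIntegrable) v v
  simp only [dotProduct_vecMulVec_mulVec] at this
  exact this

/-- The kernel of the lower excitation bound is the unexcited subspace: both bounds have the same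
rank, so their kernels agree, and the excitation of each window is squeezed in between. -/
theorem ExcitationBounds.ker_eq {q : ℕ} {T : ℝ} {Φa Φb : Matrix (Fin n) (Fin n) ℝ}
    (h : ExcitationBounds φ q T Φa Φb) : LinearMap.ker Φa.mulVecLin = unexcited φ := by
  have hle : ∀ v, ∀ t : ℝ, 0 ≤ t → v ⬝ᵥ (Φa *ᵥ v) ≤ v ⬝ᵥ (excitation φ T t *ᵥ v) := by
    intro v t ht
    have := posSemidef_dotProduct_nonneg (h.lower t ht) v
    rw [Matrix.sub_mulVec, dotProduct_sub] at this
    linarith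
  have hge : ∀ v, ∀ t : ℝ, 0 ≤ t → v ⬝ᵥ (excitation φ T t *ᵥ v) ≤ v ⬝ᵥ (Φb *ᵥ v) := by
    intro v t ht
    have := posSemidef_dotProduct_nonneg (h.upper t ht) v
    rw [Matrix.sub_mulVec, dotProduct_sub] at this
    linarith
  have hker : LinearMap.ker Φb.mulVecLin = LinearMap.ker Φa.mulVecLin := by
    refine Submodule.eq_of_le_of_finrank_eq ?_ ?_
    · intro v hv
      have hv' : Φb *ᵥ v = 0 := hv
      refine posSemidef_mulVec_eq_zero h.posSemidef_a ?_
      have := (hle v 0 le_rfl).trans (hge v 0 le_rfl)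
      rwa [hv', dotProduct_zero] at this
    · have ha := Φa.mulVecLin.finrank_range_add_finrank_ker
      have hb := Φb.mulVecLin.finrank_range_add_finrank_ker
      have h1 := h.rank_a
      have h2 := h.rank_b
      unfold Matrix.rank at h1 h2
      omega
  refine le_antisymm ?_ ?_
  · rw [← hker]
    intro v hv t ht
    have hv' : Φb *ᵥ v = 0 := hv
    have h1 := hge v t ht
    rw [hv', dotProduct_zero, dotProduct_excitation hφ h.T_pos.le ht] at h1
    by_contra hne
    have hsub : Icc t (t + T) ⊆ Ici 0 := fun u hu => ht.trans hu.1
    have := intervalIntegral.integral_pos (f := fun t => (v ⬝ᵥ φ t) ^ 2) (a := t) (b := t + T)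
      (by linarith [h.T_pos]) (((continuousOn_dotProduct hφ v).pow 2).mono hsub)
      (fun _ _ => sq_nonneg _) ⟨t, left_mem_Icc.2 (by linarith [h.T_pos]), sq_pos_of_ne_zero hne⟩
    linarith
  · intro v hv
    refine posSemidef_mulVec_eq_zero h.posSemidef_a ((hle v 0 le_rfl).trans ?_)
    rw [dotProduct_excitation hφ h.T_pos.le le_rfl, intervalIntegral.integral_congr
      (g := fun _ => (0 : ℝ))]
    · simp
    · intro τ hτ
      rw [uIcc_of_le (by linarith [h.T_pos])] at hτ
      simp [hv τ hτ.1]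

end excitation

/-! ### The filters -/

/-- The part of the estimator that does not involve the Riccati gain: information matrix, sampled
kernels, filtered projector and filtered data vector. These equations are linear once the kernels
are sampled, and they determine the Riccati gain. -/
structure FilterRun (α β γ δ : ℝ) (θ₀ : Fin n → ℝ) (φ : ℝ → Fin n → ℝ) (z : ℝ → ℝ) where
  /-- Discounted information matrix. -/
  Q : ℝ → Matrix (Fin n) (Fin n) ℝ
  Q_zero : Q 0 = 0
  Q_ode : ∀ t : ℝ, 0 ≤ t →
    HasMatrixDerivAt Q (-(β • Q t) + Matrix.vecMulVec (φ t) (φ t)) t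
  /-- Number of columns of `Nhat k`. -/
  r : ℕ → ℕ
  /-- Sampled orthonormal basis of the kernel of `Q`. -/
  Nhat : (k : ℕ) → Matrix (Fin n) (Fin (r k)) ℝ
  Nhat_basis : ∀ k : ℕ,
    IsOrthonormalBasisOf (Nhat k) (LinearMap.ker (Q ((k : ℝ) * δ)).mulVecLin)
  /-- Filtered projector. -/
  P : ℝ → Matrix (Fin n) (Fin n) ℝ
  P_zero : P 0 = 0
  P_ode : ∀ t : ℝ, 0 ≤ t → HasMatrixDerivAt P (projectorRate γ δ Nhat P t) t
  /-- Filtered data vector. -/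
  varphi : ℝ → Fin n → ℝ
  varphi_zero : varphi 0 = α • θ₀
  varphi_ode : ∀ t : ℝ, 0 ≤ t →
    HasDerivWithinAt varphi (-(β • varphi t) + z t • φ t) (Ici 0) t

section step

variable {r : ℕ → ℕ} (δ : ℝ) (N : (k : ℕ) → Matrix (Fin n) (Fin (r k)) ℝ)

/-- The piecewise constant projector signal obtained by sample-and-hold: its value at `τ` is the
projector sampled at the last multiple of `δ` before `τ` (the first sample for negative `τ`). -/
noncomputable def heldProjector (τ : ℝ) : Matrix (Fin n) (Fin n) ℝ :=
  N ⌊τ / δ⌋₊ * (N ⌊τ / δ⌋₊)ᵀ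

variable {δ N} {K : ℕ → Submodule ℝ (Fin n → ℝ)} (hN : ∀ k, IsOrthonormalBasisOf (N k) (K k))
include hN

theorem abs_heldProjector_le (τ : ℝ) (i j : Fin n) : |heldProjector δ N τ i j| ≤ 1 := by
  -- for an orthogonal projector `S`, the squared entries of row `i` sum to `S i i ≤ 1`
  set S := heldProjector δ N τ with hS
  have h1 : S * S = S := (hN _).mul_self
  have h2 : Sᵀ = S := transpose_mul_transpose_self _
  have h3 : S i i = ∑ k, S i k ^ 2 := by
    have := congrFun (congrFun h1 i) i
    rw [Matrix.mul_apply] at this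
    rw [← this]
    refine Finset.sum_congr rfl fun k _ => ?_
    have : S k i = S i k := congrFun (congrFun h2 i) k
    rw [this, pow_two]
  have h4 : S i i ≤ 1 := by
    have := (hN ⌊τ / δ⌋₊).dotProduct_projector_le (Pi.single i 1)
    simp only [Matrix.mulVec_single_one, single_one_dotProduct, Pi.single_eq_same] at this
    exact this
  have h5 : S i j ^ 2 ≤ 1 := by
    refine le_trans ?_ h4
    rw [h3]
    exact Finset.single_le_sum (f := fun k => S i k ^ 2) (fun _ _ => sq_nonneg _)
      (Finset.mem_univ j)
  exact (sq_le_one_iff_abs_le_one _).1 h5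

theorem intervalIntegrable_heldProjector (i j : Fin n) (a b : ℝ) :
    IntervalIntegrable (fun τ => heldProjector δ N τ i j) volume a b := by
  refine IntervalIntegrable.mono_fun' (g := fun _ => 1) intervalIntegrable_const ?_ ?_
  · have : Measurable fun k : ℕ => (N k * (N k)ᵀ) i j := measurable_from_nat
    exact (this.comp (Nat.measurable_floor.comp (measurable_id.div_const δ))).aestronglyMeasurable
  · exact Filter.Eventually.of_forall fun τ => abs_heldProjector_le hN τ i j

theorem intervalIntegrable_mul_heldProjector {f : ℝ → ℝ} (hf : Continuous f) (i j : Fin n)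
    (a b : ℝ) :
    IntervalIntegrable (fun τ => f τ * heldProjector δ N τ i j) volume a b :=
  (intervalIntegrable_heldProjector hN i j a b).continuousOn_mul hf.continuousOn

theorem continuous_filtered (γ : ℝ) (i j : Fin n) :
    Continuous fun t => ∫ τ in (0 : ℝ)..t, Real.exp (-γ * (t - τ)) * heldProjector δ N τ i j := by
  simp only [discounted_eq]
  exact (by fun_prop : Continuous fun t : ℝ => Real.exp (-γ * t)).mul
    (intervalIntegral.continuous_primitive
      (fun a b => intervalIntegrable_mul_heldProjector hN (by fun_prop) i j a b) 0)

/-- As a quadratic form, `γ` times the filtered projector signal lies between `0` and `1`. -/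
theorem filtered_quadForm_bounds {γ : ℝ} (hγ : 0 < γ) {t : ℝ} (ht : 0 ≤ t) (v : Fin n → ℝ) :
    0 ≤ ∫ τ in (0 : ℝ)..t, Real.exp (-γ * (t - τ)) * (v ⬝ᵥ (heldProjector δ N τ *ᵥ v)) ∧
      γ * ∫ τ in (0 : ℝ)..t, Real.exp (-γ * (t - τ)) * (v ⬝ᵥ (heldProjector δ N τ *ᵥ v))
        ≤ v ⬝ᵥ v := by
  constructor
  · exact intervalIntegral.integral_nonneg ht fun τ _ =>
      mul_nonneg (Real.exp_pos _).le (dotProduct_projector_nonneg _ _)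
  · have h1 : ∫ τ in (0 : ℝ)..t, Real.exp (-γ * (t - τ)) * (v ⬝ᵥ (heldProjector δ N τ *ᵥ v))
        ≤ ∫ τ in (0 : ℝ)..t, Real.exp (-γ * (t - τ)) * (v ⬝ᵥ v) := by
      refine intervalIntegral.integral_mono_on ht ?_ ?_ fun τ _ => ?_
      · exact (intervalIntegrable_bilin (fun i j => intervalIntegrable_heldProjector hN i j 0 t)
          v v).continuousOn_mul (by fun_prop)
      · exact (by fun_prop : Continuous fun τ : ℝ => Real.exp (-γ * (t - τ)) * (v ⬝ᵥ v)
          ).intervalIntegrable _ _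
      · exact mul_le_mul_of_nonneg_left ((hN _).dotProduct_projector_le v) (Real.exp_pos _).le
    have h2 := le_bound_of_linear_ode hγ
      (fun t ht => discounted_solves (b := γ) (continuousOn_const (c := v ⬝ᵥ v)) ht)
      (fun _ _ => le_rfl) ht
    rw [intervalIntegral.integral_same,
      max_eq_right (div_nonneg (real_dotProduct_self_nonneg v) hγ.le)] at h2
    calc _ ≤ γ * (v ⬝ᵥ v / γ) := by gcongr; exact h1.trans h2
      _ = _ := by field_simp

end step

theorem projectorRate_apply (γ δ : ℝ) {r : ℕ → ℕ} (N : (k : ℕ) → Matrix (Fin n) (Fin (r k)) ℝ)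
    (P : ℝ → Matrix (Fin n) (Fin n) ℝ) (t : ℝ) (i j : Fin n) :
    projectorRate γ δ N P t i j = -γ * P t i j + (γ * (1 : Matrix (Fin n) (Fin n) ℝ) i j
      - γ ^ 2 * ∫ τ in (0 : ℝ)..t, Real.exp (-γ * (t - τ)) * heldProjector δ N τ i j) := by
  simp [projectorRate, heldProjector]
  ring

namespace FilterRun

variable {α β γ δ : ℝ} {θ₀ : Fin n → ℝ} {φ : ℝ → Fin n → ℝ} {z : ℝ → ℝ}
  (F : FilterRun α β γ δ θ₀ φ z)

theorem Q_entry {t : ℝ} (ht : 0 ≤ t) (i j : Fin n) :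
    HasDerivWithinAt (fun s => F.Q s i j) (-β * F.Q t i j + φ t i * φ t j) (Ici 0) t :=
  (F.Q_ode t ht i j).congr_deriv (by simp [Matrix.vecMulVec_apply])

theorem Q_transpose {t : ℝ} (ht : 0 ≤ t) : (F.Q t)ᵀ = F.Q t := by
  ext i j
  exact eq_of_linear_ode (fun t ht => F.Q_entry ht j i)
    (fun t ht => (F.Q_entry ht i j).congr_deriv (by ring)) (by simp [F.Q_zero]) ht

theorem Q_quadForm {t : ℝ} (ht : 0 ≤ t) (v : Fin n → ℝ) :
    HasDerivWithinAt (fun s => v ⬝ᵥ (F.Q s *ᵥ v)) (-β * (v ⬝ᵥ (F.Q t *ᵥ v)) + (v ⬝ᵥ φ t) ^ 2)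
      (Ici 0) t := by
  refine (hasDerivWithinAt_dotProduct ((F.Q_ode t ht).mulVec (hasDerivWithinAt_const _ _ v))
    v).congr_deriv ?_
  rw [← dotProduct_vecMulVec_mulVec]
  simp [Matrix.add_mulVec, Matrix.neg_mulVec, Matrix.smul_mulVec]

theorem Q_nonneg {t : ℝ} (ht : 0 ≤ t) (v : Fin n → ℝ) : 0 ≤ v ⬝ᵥ (F.Q t *ᵥ v) :=
  nonneg_of_linear_ode (fun _ ht => F.Q_quadForm ht v) (fun _ _ => sq_nonneg _)
    (by simp [F.Q_zero]) ht

theorem Q_mulVec_eq_zero {t : ℝ} (ht : 0 ≤ t) {v : Fin n → ℝ} (hv : v ∈ unexcited φ) :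
    F.Q t *ᵥ v = 0 := by
  ext i
  refine eq_of_linear_ode (x := fun t => (F.Q t *ᵥ v) i) (y := fun _ => 0) (g := fun _ => 0)
    (b := β) (fun t ht => ?_) (fun t _ => (hasDerivWithinAt_const _ _ _).congr_deriv (by simp))
    (by simp [F.Q_zero]) ht
  have := hasDerivWithinAt_pi.1 ((F.Q_ode t ht).mulVec (hasDerivWithinAt_const _ _ v)) i
  refine this.congr_deriv ?_
  have h0 : φ t ⬝ᵥ v = 0 := by rw [dotProduct_comm]; exact hv t ht
  simp [Matrix.add_mulVec, Matrix.neg_mulVec, Matrix.smul_mulVec, Matrix.vecMulVec_mulVec, h0]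

theorem exists_Q_bound (hβ : 0 < β) (hφ_bdd : ∃ C : ℝ, ∀ t : ℝ, 0 ≤ t → eucl (φ t) ≤ C) :
    ∃ C, ∀ t, 0 ≤ t → ‖F.Q t‖ ≤ C := by
  obtain ⟨C, hC⟩ := hφ_bdd
  have := exists_norm_le_of_entries (X := F.Q) (s := Ici 0) (g := fun _ => 1) fun i j =>
    ⟨_, fun t ht => by
      rw [mul_one]
      refine abs_bound_of_linear_ode (C := C * C) hβ (fun t ht => F.Q_entry ht i j)
        (fun t ht => ?_) ht
      rw [abs_mul]
      have h0 : ∀ k, |φ t k| ≤ C := fun k => (abs_apply_le_eucl _ k).trans (hC t ht)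
      exact mul_le_mul (h0 i) (h0 j) (abs_nonneg _) ((abs_nonneg _).trans (h0 i))⟩
  simpa using this

theorem exists_varphi_bound (hβ : 0 < β)
    (hφ_bdd : ∃ C : ℝ, ∀ t : ℝ, 0 ≤ t → eucl (φ t) ≤ C)
    (hz_bdd : ∃ C : ℝ, ∀ t : ℝ, 0 ≤ t → |z t| ≤ C) :
    ∃ C, ∀ t, 0 ≤ t → eucl (F.varphi t) ≤ C := by
  obtain ⟨C, hC⟩ := hφ_bdd
  obtain ⟨B, hB⟩ := hz_bdd
  have key : ∀ i, ∀ t, 0 ≤ t → |F.varphi t i| ≤ max |F.varphi 0 i| (B * C / β) := fun i t ht => by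
    refine abs_bound_of_linear_ode (x := fun t => F.varphi t i) (g := fun t => z t * φ t i) hβ
      (fun t ht => (hasDerivWithinAt_pi.1 (F.varphi_ode t ht) i).congr_deriv (by simp))
      (fun t ht => ?_) ht
    rw [abs_mul]
    exact mul_le_mul (hB t ht) ((abs_apply_le_eucl _ i).trans (hC t ht)) (abs_nonneg _)
      ((abs_nonneg _).trans (hB t ht))
  refine ⟨Real.sqrt n * ∑ i, max |F.varphi 0 i| (B * C / β), fun t ht =>
    (eucl_le_norm _).trans ?_⟩
  gcongr
  have hnn : ∀ i, 0 ≤ max |F.varphi 0 i| (B * C / β) := fun i => le_max_of_le_left (abs_nonneg _)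
  refine (pi_norm_le_iff_of_nonneg (Finset.sum_nonneg fun i _ => hnn i)).2 fun i =>
    (key i t ht).trans ?_
  exact Finset.single_le_sum (f := fun i => max |F.varphi 0 i| (B * C / β)) (fun i _ => hnn i)
    (Finset.mem_univ i)

/-- The information matrix remembers, up to discounting, the excitation of the last window. -/
theorem Q_lower (hβ : 0 < β) (hφ : ContinuousOn φ (Ici 0)) {q : ℕ} {T : ℝ}
    {Φa Φb : Matrix (Fin n) (Fin n) ℝ} (h : ExcitationBounds φ q T Φa Φb) {t : ℝ} (ht : T ≤ t)
    (v : Fin n → ℝ) : Real.exp (-β * T) * (v ⬝ᵥ (Φa *ᵥ v)) ≤ v ⬝ᵥ (F.Q t *ᵥ v) := by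
  have h0 : 0 ≤ t - T := sub_nonneg.2 ht
  have h1 := exp_mul_integral_le hβ.le (fun _ ht => F.Q_quadForm ht v) (by simp [F.Q_zero])
    ((continuousOn_dotProduct hφ v).pow 2) (fun _ _ => sq_nonneg _) h0 h.T_pos.le
  rw [← dotProduct_excitation hφ h.T_pos.le h0, sub_add_cancel] at h1
  refine le_trans (mul_le_mul_of_nonneg_left ?_ (Real.exp_pos _).le) h1
  have := posSemidef_dotProduct_nonneg (h.lower _ h0) v
  rw [Matrix.sub_mulVec, dotProduct_sub] at this
  linarith

/-- After one excitation window the kernel of the information matrix has settled. -/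
theorem ker_Q (hβ : 0 < β) (hφ : ContinuousOn φ (Ici 0)) {q : ℕ} {T : ℝ}
    {Φa Φb : Matrix (Fin n) (Fin n) ℝ} (h : ExcitationBounds φ q T Φa Φb) {t : ℝ} (ht : T ≤ t) :
    LinearMap.ker (F.Q t).mulVecLin = unexcited φ := by
  refine le_antisymm ?_ fun v hv => F.Q_mulVec_eq_zero (h.T_pos.le.trans ht) hv
  intro v hv
  have hv' : F.Q t *ᵥ v = 0 := hv
  rw [← h.ker_eq hφ]
  refine posSemidef_mulVec_eq_zero h.posSemidef_a ?_
  have h1 := F.Q_lower hβ hφ h ht v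
  rw [hv', dotProduct_zero] at h1
  exact nonpos_of_mul_nonpos_right h1 (Real.exp_pos _)

theorem P_entry {t : ℝ} (ht : 0 ≤ t) (i j : Fin n) :
    HasDerivWithinAt (fun s => F.P s i j) (-γ * F.P t i j
      + (γ * (1 : Matrix (Fin n) (Fin n) ℝ) i j - γ ^ 2 *
        ∫ τ in (0 : ℝ)..t, Real.exp (-γ * (t - τ)) * heldProjector δ F.Nhat τ i j)) (Ici 0) t :=
  (F.P_ode t ht i j).congr_deriv (projectorRate_apply _ _ _ _ _ _ _)

theorem P_transpose {t : ℝ} (ht : 0 ≤ t) : (F.P t)ᵀ = F.P t := by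
  ext i j
  have hsymm : ∀ τ, heldProjector δ F.Nhat τ j i = heldProjector δ F.Nhat τ i j := fun τ =>
    congrFun (congrFun (transpose_mul_transpose_self _) i) j
  have h1 : (1 : Matrix (Fin n) (Fin n) ℝ) j i = (1 : Matrix (Fin n) (Fin n) ℝ) i j :=
    congrFun (congrFun Matrix.transpose_one i) j
  refine eq_of_linear_ode (fun t ht => F.P_entry ht j i)
    (fun t ht => (F.P_entry ht i j).congr_deriv ?_) (by simp [F.P_zero]) ht
  simp only [hsymm, h1]

theorem continuousOn_P : ContinuousOn F.P (Ici 0) := fun t ht =>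
  (hasMatrixDerivAt_iff.1 (F.P_ode t ht)).continuousWithinAt

theorem continuousOn_Q : ContinuousOn F.Q (Ici 0) := fun t ht =>
  (hasMatrixDerivAt_iff.1 (F.Q_ode t ht)).continuousWithinAt

theorem continuousOn_projectorRate :
    ContinuousOn (fun t => projectorRate γ δ F.Nhat F.P t) (Ici 0) := by
  refine continuousOn_pi.2 fun i => continuousOn_pi.2 fun j => ?_
  simp only [projectorRate_apply]
  exact (continuousOn_const.mul (continuousOn_pi.1 (continuousOn_pi.1 F.continuousOn_P i) j)).add
    (continuousOn_const.sub (continuousOn_const.mul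
      (continuous_filtered F.Nhat_basis γ i j).continuousOn))

theorem P_quadForm {t : ℝ} (ht : 0 ≤ t) (v : Fin n → ℝ) :
    HasDerivWithinAt (fun s => v ⬝ᵥ (F.P s *ᵥ v)) (-γ * (v ⬝ᵥ (F.P t *ᵥ v))
      + (γ * (v ⬝ᵥ v) - γ ^ 2 * ∫ τ in (0 : ℝ)..t,
        Real.exp (-γ * (t - τ)) * (v ⬝ᵥ (heldProjector δ F.Nhat τ *ᵥ v)))) (Ici 0) t := by
  refine (hasDerivWithinAt_dotProduct ((F.P_ode t ht).mulVec (hasDerivWithinAt_const _ _ v))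
    v).congr_deriv ?_
  have h1 := dotProduct_integral_mulVec
    (A := fun τ => Real.exp (-γ * (t - τ)) • heldProjector δ F.Nhat τ) (a := 0) (b := t)
    (fun i j => intervalIntegrable_mul_heldProjector F.Nhat_basis (by fun_prop) i j 0 t) v v
  simp only [Matrix.smul_apply, smul_eq_mul, Matrix.smul_mulVec, dotProduct_smul] at h1
  rw [← h1]
  simp only [projectorRate, Matrix.sub_mulVec, Matrix.add_mulVec, Matrix.neg_mulVec,
    Matrix.smul_mulVec, Matrix.mulVec_zero, Matrix.one_mulVec, dotProduct_add, dotProduct_sub,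
    dotProduct_neg, dotProduct_smul, smul_eq_mul, dotProduct_zero, heldProjector]
  ring

theorem P_nonneg (hγ : 0 < γ) {t : ℝ} (ht : 0 ≤ t) (v : Fin n → ℝ) :
    0 ≤ v ⬝ᵥ (F.P t *ᵥ v) := by
  refine nonneg_of_linear_ode (fun _ ht => F.P_quadForm ht v) (fun t ht => ?_)
    (by simp [F.P_zero]) ht
  have := (filtered_quadForm_bounds F.Nhat_basis hγ ht v (δ := δ)).2
  nlinarith

theorem P_le (hγ : 0 < γ) {t : ℝ} (ht : 0 ≤ t) (v : Fin n → ℝ) :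
    v ⬝ᵥ (F.P t *ᵥ v) ≤ v ⬝ᵥ v := by
  refine le_of_linear_ode (y := fun _ => v ⬝ᵥ v) (g := fun _ => γ * (v ⬝ᵥ v))
    (fun _ ht => F.P_quadForm ht v)
    (fun _ _ => (hasDerivWithinAt_const _ _ _).congr_deriv (by ring)) (fun t ht => ?_)
    (by simpa [F.P_zero] using real_dotProduct_self_nonneg v) ht
  have := (filtered_quadForm_bounds F.Nhat_basis hγ ht v (δ := δ)).1
  nlinarith [sq_nonneg γ]

end FilterRun

/-! ### Closed form of the Riccati gain -/

namespace FilterRun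

variable (F : FilterRun α β γ δ θ₀ φ z)

/-- The inverse gain `M = P Q P + α e^{-βt} P + κ (1 - P)` with the free parameter `κ`; the Riccati
gain turns out to be its inverse. -/
noncomputable def gainInv (κ : ℝ) (t : ℝ) : Matrix (Fin n) (Fin n) ℝ :=
  F.P t * F.Q t * F.P t + (α * Real.exp (-β * t)) • F.P t + κ • (1 - F.P t)

/-- The weight `R` along the run. -/
noncomputable def weight (κ : ℝ) (t : ℝ) : Matrix (Fin n) (Fin n) ℝ :=
  riccatiWeight α β κ t (F.P t) (F.Q t) (projectorRate γ δ F.Nhat F.P t) (φ t)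

theorem gainInv_zero : F.gainInv κ 0 = κ • (1 : Matrix (Fin n) (Fin n) ℝ) := by
  simp [gainInv, F.P_zero]

theorem gainInv_quadForm {t : ℝ} (ht : 0 ≤ t) (v : Fin n → ℝ) :
    v ⬝ᵥ (F.gainInv κ t *ᵥ v) = (F.P t *ᵥ v) ⬝ᵥ (F.Q t *ᵥ (F.P t *ᵥ v))
      + α * Real.exp (-β * t) * (v ⬝ᵥ (F.P t *ᵥ v)) + κ * (v ⬝ᵥ v - v ⬝ᵥ (F.P t *ᵥ v)) := by
  rw [← dotProduct_mulVec_comm (F.P_transpose ht)]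
  simp only [gainInv, Matrix.add_mulVec, Matrix.smul_mulVec, Matrix.sub_mulVec, dotProduct_add,
    dotProduct_smul, dotProduct_sub, Matrix.one_mulVec, smul_eq_mul, Matrix.mulVec_mulVec,
    Matrix.mul_assoc]

/-- Positivity of the inverse gain, a consequence of `0 ≤ P ≤ 1`. -/
theorem gainInv_pos (hα : 0 < α) (hκ : 0 < κ) (hγ : 0 < γ) {t : ℝ} (ht : 0 ≤ t) {v : Fin n → ℝ}
    (hv : v ≠ 0) : 0 < v ⬝ᵥ (F.gainInv κ t *ᵥ v) := by
  rw [F.gainInv_quadForm ht]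
  have h1 := F.Q_nonneg ht (F.P t *ᵥ v)
  have h2 := F.P_nonneg hγ ht v
  have h3 := F.P_le hγ ht v
  have h4 : 0 < v ⬝ᵥ v :=
    (real_dotProduct_self_nonneg v).lt_of_ne' (fun h => hv (dotProduct_self_eq_zero.1 h))
  have ha : 0 < α * Real.exp (-β * t) := by positivity
  rcases h2.eq_or_lt with h | h
  · rw [← h]
    have := mul_pos hκ h4
    linarith
  · have := mul_pos ha h
    have := mul_nonneg hκ.le (sub_nonneg.2 h3)
    linarith

theorem isUnit_gainInv (hα : 0 < α) (hκ : 0 < κ) (hγ : 0 < γ) {t : ℝ} (ht : 0 ≤ t) :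
    IsUnit (F.gainInv κ t) := by
  rw [← Matrix.mulVec_injective_iff_isUnit]
  refine (injective_iff_map_eq_zero (F.gainInv κ t).mulVecLin).2 fun v hv => ?_
  by_contra hne
  have := F.gainInv_pos hα hκ hγ ht hne
  rw [show F.gainInv κ t *ᵥ v = 0 from hv, dotProduct_zero] at this
  exact lt_irrefl _ this

/-- The inverse gain solves the linear equation `M' = -β M + R`. -/
theorem gainInv_ode {t : ℝ} (ht : 0 ≤ t) :
    HasMatrixDerivAt (F.gainInv κ) (-(β • F.gainInv κ t) + F.weight κ t) t := by
  have hP := hasMatrixDerivAt_iff.1 (F.P_ode t ht)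
  have hQ := hasMatrixDerivAt_iff.1 (F.Q_ode t ht)
  rw [hasMatrixDerivAt_iff]
  refine ((((hP.mul hQ).mul hP).add ((hasDerivWithinAt_decay α β t).smul hP)).add
    ((hP.const_sub 1).const_smul κ)).congr_deriv ?_
  simp only [gainInv, weight, riccatiWeight, Pi.mul_apply, mul_add, add_mul, mul_neg, neg_mul,
    Matrix.smul_mul, Matrix.mul_smul, Matrix.mul_assoc]
  module

theorem continuousOn_weight (hφ : ContinuousOn φ (Ici 0)) :
    ContinuousOn (F.weight κ) (Ici 0) := by
  have h1 := F.continuousOn_P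
  have h2 := F.continuousOn_Q
  have h3 := F.continuousOn_projectorRate
  have h4 : ContinuousOn (fun t => Matrix.vecMulVec (φ t) (φ t)) (Ici 0) :=
    continuousOn_pi.2 fun i => continuousOn_pi.2 fun j => by
      simp only [Matrix.vecMulVec_apply]
      exact (continuousOn_apply hφ i).mul (continuousOn_apply hφ j)
  have h5 : ContinuousOn (fun t => α * Real.exp (-β * t) - κ) (Ici 0) := by fun_prop
  have a1 := (h1.mul h4).mul h1
  have a2 : ContinuousOn (fun t => (κ * β) • (1 - F.P t)) (Ici 0) := by fun_prop
  have a3 := (h3.mul h2).mul h1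
  have a4 := (h1.mul h2).mul h3
  have a5 := h5.smul h3
  exact (((a1.add a2).add a3).add a4).add a5

theorem P_varphi_ode {t : ℝ} (ht : 0 ≤ t) :
    HasDerivWithinAt (fun s => F.P s *ᵥ F.varphi s)
      (projectorRate γ δ F.Nhat F.P t *ᵥ F.varphi t
        + F.P t *ᵥ (-(β • F.varphi t) + z t • φ t)) (Ici 0) t :=
  (F.P_ode t ht).mulVec (F.varphi_ode t ht)

end FilterRun

/-- The filters underlying a run of the estimator. -/
noncomputable def EstimatorRun.toFilterRun (E : EstimatorRun α β γ δ κ θ₀ φ z) :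
    FilterRun α β γ δ θ₀ φ z where
  Q := E.Q
  Q_zero := E.Q_zero
  Q_ode := E.Q_ode
  r := E.r
  Nhat := E.Nhat
  Nhat_basis := E.Nhat_basis
  P := E.P
  P_zero := E.P_zero
  P_ode := E.P_ode
  varphi := E.varphi
  varphi_zero := E.varphi_zero
  varphi_ode := E.varphi_ode

/-- The Riccati gain is the inverse of `gainInv`: the defect `1 - Ω M` solves a homogeneous linear
equation and starts at zero. -/
theorem EstimatorRun.Ω_mul_gainInv (E : EstimatorRun α β γ δ κ θ₀ φ z)
    (hφ : ContinuousOn φ (Ici 0)) (hκ : 0 < κ) {t : ℝ} (ht : 0 ≤ t) :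
    E.Ω t * E.toFilterRun.gainInv κ t = 1 := by
  have hΩ : ∀ t, 0 ≤ t → HasMatrixDerivAt E.Ω
      (β • E.Ω t - E.Ω t * E.toFilterRun.weight κ t * E.Ω t) t := E.Ω_ode
  have hcont : ContinuousOn (fun t => -(E.Ω t * E.toFilterRun.weight κ t)) (Ici 0) :=
    (ContinuousOn.mul (fun t ht => (hasMatrixDerivAt_iff.1 (hΩ t ht)).continuousWithinAt)
      (E.toFilterRun.continuousOn_weight hφ)).neg
  have := eq_zero_of_homogeneous
    (X := fun t => 1 - E.Ω t * E.toFilterRun.gainInv κ t) (fun t ht => ?_) hcont ?_ ht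
  · exact (sub_eq_zero.1 this).symm
  · have h := (hΩ t ht).mul (E.toFilterRun.gainInv_ode (κ := κ) ht)
    rw [hasMatrixDerivAt_iff] at h ⊢
    refine (h.const_sub 1).congr_deriv ?_
    simp only [sub_mul, mul_sub, mul_add, mul_neg, neg_mul, Matrix.smul_mul,
      Matrix.mul_smul, Matrix.mul_assoc, mul_one]
    module
  · simp [E.Ω_zero, FilterRun.gainInv_zero, smul_smul, hκ.ne']

theorem EstimatorRun.gainInv_mul_Ω (E : EstimatorRun α β γ δ κ θ₀ φ z)
    (hφ : ContinuousOn φ (Ici 0)) (hκ : 0 < κ) {t : ℝ} (ht : 0 ≤ t) :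
    E.toFilterRun.gainInv κ t * E.Ω t = 1 :=
  mul_eq_one_comm.1 (E.Ω_mul_gainInv hφ hκ ht)

/-- Closed form of the adaptive component: `M θd` and `P ϕ` both vanish at `0` and solve
`y' = -β y + z P φ + P' ϕ`. -/
theorem EstimatorRun.gainInv_mulVec_θd (E : EstimatorRun α β γ δ κ θ₀ φ z)
    (hφ : ContinuousOn φ (Ici 0)) (hκ : 0 < κ) {t : ℝ} (ht : 0 ≤ t) :
    E.toFilterRun.gainInv κ t *ᵥ E.θd t = E.P t *ᵥ E.varphi t := by
  have hθ : ∀ t, 0 ≤ t → HasDerivWithinAt E.θd (-(E.Ω t *ᵥ (E.toFilterRun.weight κ t *ᵥ E.θd t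
      - z t • (E.P t *ᵥ φ t) - projectorRate γ δ E.Nhat E.P t *ᵥ E.varphi t))) (Ici 0) t := E.θd_ode
  ext i
  refine eq_of_linear_ode (x := fun t => (E.toFilterRun.gainInv κ t *ᵥ E.θd t) i)
    (y := fun t => (E.P t *ᵥ E.varphi t) i) (b := β)
    (g := fun t => (z t • (E.P t *ᵥ φ t) + projectorRate γ δ E.Nhat E.P t *ᵥ E.varphi t) i)
    (fun t ht => ?_) (fun t ht => ?_) ?_ ht
  · have h := (E.toFilterRun.gainInv_ode (κ := κ) ht).mulVec (hθ t ht)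
    refine (hasDerivWithinAt_pi.1 h i).congr_deriv ?_
    rw [Matrix.mulVec_neg, Matrix.mulVec_mulVec, E.gainInv_mul_Ω hφ hκ ht, Matrix.one_mulVec]
    simp only [Matrix.add_mulVec, Matrix.neg_mulVec, Matrix.smul_mulVec, Pi.add_apply,
      Pi.neg_apply, Pi.sub_apply, Pi.smul_apply, smul_eq_mul]
    ring
  · refine (hasDerivWithinAt_pi.1 (E.toFilterRun.P_varphi_ode ht) i).congr_deriv ?_
    simp only [Matrix.mulVec_add, Matrix.mulVec_neg, Matrix.mulVec_smul, Pi.add_apply,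
      Pi.neg_apply, Pi.smul_apply, smul_eq_mul]
    simp only [EstimatorRun.toFilterRun]
    ring
  · simp [E.θd_zero, E.P_zero]

/-- Every run of the filters extends to a run of the estimator. -/
theorem FilterRun.nonempty_estimatorRun (F : FilterRun α β γ δ θ₀ φ z) (hα : 0 < α) (hκ : 0 < κ)
    (hγ : 0 < γ) : Nonempty (EstimatorRun α β γ δ κ θ₀ φ z) := by
  have hu : ∀ t, 0 ≤ t → IsUnit (F.gainInv κ t).det := fun t ht =>
    (Matrix.isUnit_iff_isUnit_det _).1 (F.isUnit_gainInv hα hκ hγ ht)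
  have hΩ : ∀ t, 0 ≤ t → HasMatrixDerivAt (fun t => (F.gainInv κ t)⁻¹)
      (β • (F.gainInv κ t)⁻¹ - (F.gainInv κ t)⁻¹ * F.weight κ t * (F.gainInv κ t)⁻¹) t := by
    intro t ht
    have h := (F.gainInv_ode (κ := κ) ht).inv (F.isUnit_gainInv hα hκ hγ ht)
    convert h using 1
    rw [mul_add, add_mul, mul_neg, neg_mul, Matrix.mul_smul, Matrix.smul_mul,
      Matrix.nonsing_inv_mul _ (hu t ht), one_mul]
    abel
  refine ⟨{ Q := F.Q, Q_zero := F.Q_zero, Q_ode := F.Q_ode, r := F.r, Nhat := F.Nhat,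
            Nhat_basis := F.Nhat_basis, P := F.P, P_zero := F.P_zero, P_ode := F.P_ode,
            varphi := F.varphi, varphi_zero := F.varphi_zero, varphi_ode := F.varphi_ode,
            Ω := fun t => (F.gainInv κ t)⁻¹, Ω_zero := ?_, Ω_ode := hΩ,
            θd := fun t => (F.gainInv κ t)⁻¹ *ᵥ (F.P t *ᵥ F.varphi t), θd_zero := ?_,
            θd_ode := fun t ht => ?_ }⟩
  · rw [F.gainInv_zero]
    refine Matrix.inv_eq_right_inv ?_
    simp [smul_smul, hκ.ne']
  · simp [F.P_zero]
  · refine ((hΩ t ht).mulVec (F.P_varphi_ode ht)).congr_deriv ?_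
    change _ = -((F.gainInv κ t)⁻¹ *ᵥ (F.weight κ t *ᵥ _ - _ - _))
    simp only [Matrix.sub_mulVec, Matrix.mulVec_sub, Matrix.mulVec_add, Matrix.mulVec_neg,
      Matrix.mulVec_smul, Matrix.smul_mulVec, ← Matrix.mulVec_mulVec]
    module

/-- The filter equations have a global solution. -/
theorem nonempty_filterRun (α β γ δ : ℝ) (θ₀ : Fin n → ℝ) (hφ : ContinuousOn φ (Ici 0))
    (hz : ContinuousOn z (Ici 0)) : Nonempty (FilterRun α β γ δ θ₀ φ z) := by
  choose Q hQ0 hQ using fun i j : Fin n => exists_linear_ode β 0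
    ((continuousOn_apply hφ i).mul (continuousOn_apply hφ j))
  choose r N hN using fun k : ℕ => exists_isOrthonormalBasisOf
    (LinearMap.ker (Matrix.of fun i j => Q i j ((k : ℝ) * δ)).mulVecLin)
  choose P hP0 hP using fun i j : Fin n => exists_linear_ode γ 0
    (g := fun t => γ * (1 : Matrix (Fin n) (Fin n) ℝ) i j - γ ^ 2 *
      ∫ τ in (0 : ℝ)..t, Real.exp (-γ * (t - τ)) * heldProjector δ N τ i j)
    (continuousOn_const.sub (continuousOn_const.mul
      (continuous_filtered hN γ i j).continuousOn))
  choose v hv0 hv using fun i : Fin n => exists_linear_ode β (α * θ₀ i)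
    (hz.mul (continuousOn_apply hφ i))
  exact ⟨{ Q := fun t => Matrix.of fun i j => Q i j t
           Q_zero := by ext i j; exact hQ0 i j
           Q_ode := fun t ht i j => (hQ i j t ht).congr_deriv (by simp [Matrix.vecMulVec_apply])
           r := r
           Nhat := N
           Nhat_basis := hN
           P := fun t => Matrix.of fun i j => P i j t
           P_zero := by ext i j; exact hP0 i j
           P_ode := fun t ht i j => (hP i j t ht).congr_deriv (projectorRate_apply γ δ N
             (fun t => Matrix.of fun i j => P i j t) t i j).symm
           varphi := fun t i => v i t
           varphi_zero := by ext i; exact hv0 i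
           varphi_ode := fun t ht => hasDerivWithinAt_pi.2 fun i =>
             (hv i t ht).congr_deriv (by simp) }⟩

/-! ### Least squares -/

namespace FilterRun

variable (F : FilterRun α β γ δ θ₀ φ z)

/-- Matrix of the normal equations: the Hessian of the cost. -/
noncomputable def hessian (t : ℝ) : Matrix (Fin n) (Fin n) ℝ :=
  F.Q t + (α * Real.exp (-β * t)) • 1

theorem hessian_mulVec (t : ℝ) (v : Fin n → ℝ) :
    F.hessian t *ᵥ v = F.Q t *ᵥ v + (α * Real.exp (-β * t)) • v := by
  simp only [hessian, Matrix.add_mulVec, Matrix.smul_mulVec, Matrix.one_mulVec]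

theorem hessian_coercive {t : ℝ} (ht : 0 ≤ t) (v : Fin n → ℝ) :
    α * Real.exp (-β * t) * (v ⬝ᵥ v) ≤ v ⬝ᵥ (F.hessian t *ᵥ v) := by
  rw [hessian_mulVec, dotProduct_add, dotProduct_smul, smul_eq_mul]
  linarith [F.Q_nonneg ht v]

/-- The cost in terms of the filter states: the discounted squared residual and its expansion solve
the same linear equation. -/
theorem cost_eq (hφ : ContinuousOn φ (Ici 0)) (hz : ContinuousOn z (Ici 0)) {t : ℝ} (ht : 0 ≤ t)
    (ϑ : Fin n → ℝ) :
    cost α β θ₀ φ z t ϑ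
      = (1 / 2) * ((∫ τ in (0 : ℝ)..t, Real.exp (-β * (t - τ)) * z τ ^ 2)
        - 2 * (ϑ ⬝ᵥ F.varphi t - α * Real.exp (-β * t) * (ϑ ⬝ᵥ θ₀)) + ϑ ⬝ᵥ (F.Q t *ᵥ ϑ))
        + (α / 2) * Real.exp (-β * t) * ((ϑ - θ₀) ⬝ᵥ (ϑ - θ₀)) := by
  rw [cost, eucl_sq]
  congr 2
  refine eq_of_linear_ode (fun t ht => discounted_solves (b := β)
    ((hz.sub (continuousOn_dotProduct hφ ϑ)).pow 2) ht)
    (y := fun t => (∫ τ in (0 : ℝ)..t, Real.exp (-β * (t - τ)) * z τ ^ 2)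
        - 2 * (ϑ ⬝ᵥ F.varphi t - α * Real.exp (-β * t) * (ϑ ⬝ᵥ θ₀)) + ϑ ⬝ᵥ (F.Q t *ᵥ ϑ))
    (fun t ht => ?_) ?_ ht
  · refine (((discounted_solves (b := β) (hz.pow 2) ht).sub
      (((hasDerivWithinAt_dotProduct (F.varphi_ode t ht) ϑ).sub
        ((hasDerivWithinAt_decay α β t).mul_const (ϑ ⬝ᵥ θ₀))).const_mul 2)).add
      (F.Q_quadForm ht ϑ)).congr_deriv ?_
    simp only [dotProduct_add, dotProduct_neg, dotProduct_smul, smul_eq_mul, Pi.pow_apply,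
      Pi.sub_apply]
    ring
  · simp [F.varphi_zero, F.Q_zero]

/-- Completing the square: second order expansion of the cost. -/
theorem cost_sub (hφ : ContinuousOn φ (Ici 0)) (hz : ContinuousOn z (Ici 0)) {t : ℝ} (ht : 0 ≤ t)
    (ϑ h : Fin n → ℝ) :
    cost α β θ₀ φ z t (ϑ + h) - cost α β θ₀ φ z t ϑ
      = (1 / 2) * (h ⬝ᵥ (F.hessian t *ᵥ h)) + h ⬝ᵥ (F.hessian t *ᵥ ϑ - F.varphi t) := by
  rw [F.cost_eq hφ hz ht, F.cost_eq hφ hz ht]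
  have h1 : ϑ ⬝ᵥ (F.Q t *ᵥ h) = h ⬝ᵥ (F.Q t *ᵥ ϑ) := by
    rw [dotProduct_mulVec_comm (F.Q_transpose ht), dotProduct_comm]
  simp only [hessian_mulVec, Matrix.mulVec_add, dotProduct_add, add_dotProduct, dotProduct_sub,
    sub_dotProduct, dotProduct_smul, smul_eq_mul, h1]
  rw [dotProduct_comm ϑ h, dotProduct_comm θ₀ h, dotProduct_comm θ₀ ϑ]
  ring

theorem isUnit_hessian (hα : 0 < α) {t : ℝ} (ht : 0 ≤ t) : IsUnit (F.hessian t).det := by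
  rw [← Matrix.isUnit_iff_isUnit_det, ← Matrix.mulVec_injective_iff_isUnit]
  refine (injective_iff_map_eq_zero (F.hessian t).mulVecLin).2 fun v hv => ?_
  have h := F.hessian_coercive ht v
  rw [show F.hessian t *ᵥ v = 0 from hv, dotProduct_zero] at h
  have ha : 0 < α * Real.exp (-β * t) := by positivity
  exact dotProduct_self_eq_zero.1
    (le_antisymm (nonpos_of_mul_nonpos_right h ha) (real_dotProduct_self_nonneg v))

/-- Minimizers of the cost are the solutions of the normal equations. -/
theorem isLeastSquares_iff (hα : 0 < α) (hφ : ContinuousOn φ (Ici 0)) (hz : ContinuousOn z (Ici 0))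
    {t : ℝ} (ht : 0 ≤ t) (ϑ : Fin n → ℝ) :
    IsLeastSquares α β θ₀ φ z t ϑ ↔ F.hessian t *ᵥ ϑ = F.varphi t := by
  have ha : 0 < α * Real.exp (-β * t) := by positivity
  have hpos : ∀ v, 0 ≤ v ⬝ᵥ (F.hessian t *ᵥ v) := fun v =>
    (mul_nonneg ha.le (real_dotProduct_self_nonneg v)).trans (F.hessian_coercive ht v)
  constructor
  · intro h
    set ϑ₁ := (F.hessian t)⁻¹ *ᵥ F.varphi t
    have h1 : F.hessian t *ᵥ ϑ₁ = F.varphi t := by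
      rw [Matrix.mulVec_mulVec, Matrix.mul_nonsing_inv _ (F.isUnit_hessian hα ht),
        Matrix.one_mulVec]
    have h2 := F.cost_sub hφ hz ht ϑ₁ (ϑ - ϑ₁)
    rw [h1, sub_self, dotProduct_zero, add_sub_cancel] at h2
    have h3 := h ϑ₁
    have h4 := F.hessian_coercive ht (ϑ - ϑ₁)
    have h5 : (ϑ - ϑ₁) ⬝ᵥ (ϑ - ϑ₁) ≤ 0 := nonpos_of_mul_nonpos_right (by linarith) ha
    have h6 := dotProduct_self_eq_zero.1 (le_antisymm h5 (real_dotProduct_self_nonneg _))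
    rw [sub_eq_zero.1 h6, h1]
  · intro h ϑ'
    have h2 := F.cost_sub hφ hz ht ϑ (ϑ' - ϑ)
    rw [h, sub_self, dotProduct_zero, add_sub_cancel] at h2
    linarith [hpos (ϑ' - ϑ)]

include F in
theorem existsUnique_isLeastSquares (hα : 0 < α) (hφ : ContinuousOn φ (Ici 0))
    (hz : ContinuousOn z (Ici 0)) {t : ℝ} (ht : 0 ≤ t) :
    ∃! ϑ : Fin n → ℝ, IsLeastSquares α β θ₀ φ z t ϑ := by
  have hu := F.isUnit_hessian hα ht
  refine ⟨(F.hessian t)⁻¹ *ᵥ F.varphi t, ?_, fun ϑ h => ?_⟩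
  · refine (F.isLeastSquares_iff hα hφ hz ht _).2 ?_
    rw [Matrix.mulVec_mulVec, Matrix.mul_nonsing_inv _ hu, Matrix.one_mulVec]
  · have h' := (F.isLeastSquares_iff hα hφ hz ht ϑ).1 h
    rw [← h', Matrix.mulVec_mulVec, Matrix.nonsing_inv_mul _ hu, Matrix.one_mulVec]

/-- Along unexcited directions the data carry only the discounted prior. -/
theorem dotProduct_varphi {v : Fin n → ℝ} (hv : v ∈ unexcited φ) {t : ℝ} (ht : 0 ≤ t) :
    v ⬝ᵥ F.varphi t = α * Real.exp (-β * t) * (v ⬝ᵥ θ₀) := by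
  refine eq_of_linear_ode (g := fun _ => 0) (y := fun t => α * Real.exp (-β * t) * (v ⬝ᵥ θ₀))
    (fun t ht => (hasDerivWithinAt_dotProduct (F.varphi_ode t ht) v).congr_deriv ?_)
    (fun t _ => ((hasDerivWithinAt_decay α β t).mul_const (v ⬝ᵥ θ₀)).congr_deriv (by ring))
    (by simp [F.varphi_zero]) ht
  have : v ⬝ᵥ φ t = 0 := hv t ht
  simp [dotProduct_add, this]

/-- In the noise-free case the data vector is generated by the true parameter. -/
theorem varphi_eq_of_noise_free {θ : Fin n → ℝ} (hz : ∀ t : ℝ, 0 ≤ t → z t = φ t ⬝ᵥ θ) {t : ℝ}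
    (ht : 0 ≤ t) : F.varphi t = F.Q t *ᵥ θ + (α * Real.exp (-β * t)) • θ₀ := by
  ext i
  refine eq_of_linear_ode (x := fun t => F.varphi t i) (b := β) (g := fun t => z t * φ t i)
    (y := fun t => (F.Q t *ᵥ θ) i + α * Real.exp (-β * t) * θ₀ i)
    (fun t ht => (hasDerivWithinAt_pi.1 (F.varphi_ode t ht) i).congr_deriv (by simp))
    (fun t ht => ?_) (by simp [F.varphi_zero, F.Q_zero]) ht
  have h := hasDerivWithinAt_pi.1 ((F.Q_ode t ht).mulVec (hasDerivWithinAt_const _ _ θ)) i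
  refine (h.add ((hasDerivWithinAt_decay α β t).mul_const (θ₀ i))).congr_deriv ?_
  simp [Matrix.add_mulVec, Matrix.neg_mulVec, Matrix.smul_mulVec, Matrix.vecMulVec_mulVec, hz t ht]
  ring

/-! ### Convergence of the filtered projector -/

section limit

variable {m : ℕ} {N : Matrix (Fin n) (Fin m) ℝ} (hN : IsOrthonormalBasisOf N (unexcited φ))
include hN

theorem Q_mul_projector {t : ℝ} (ht : 0 ≤ t) : F.Q t * (N * Nᵀ) = 0 := by
  refine Matrix.ext_of_mulVec_single fun i => ?_
  rw [← Matrix.mulVec_mulVec, F.Q_mulVec_eq_zero ht (hN.mulVec_mem _), Matrix.zero_mulVec]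

theorem projector_mul_Q {t : ℝ} (ht : 0 ≤ t) : (N * Nᵀ) * F.Q t = 0 := by
  have := congrArg Matrix.transpose (F.Q_mul_projector hN ht)
  rwa [Matrix.transpose_mul, transpose_mul_transpose_self, F.Q_transpose ht,
    Matrix.transpose_zero] at this

/-- The least squares solution agrees with the prior estimate on the unexcited subspace. -/
theorem projector_mulVec_leastSquares (hα : 0 < α) {t : ℝ} (ht : 0 ≤ t) {ϑ : Fin n → ℝ}
    (h : F.hessian t *ᵥ ϑ = F.varphi t) : (N * Nᵀ) *ᵥ ϑ = (N * Nᵀ) *ᵥ θ₀ := by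
  have ha : α * Real.exp (-β * t) ≠ 0 := by positivity
  have hS := transpose_mul_transpose_self N
  ext i
  have hv := hN.mulVec_mem (Pi.single i 1)
  have hrow : ∀ x, ((N * Nᵀ) *ᵥ x) i = ((N * Nᵀ) *ᵥ Pi.single i 1) ⬝ᵥ x := fun x => by
    rw [← dotProduct_mulVec_comm hS, single_one_dotProduct]
  rw [hrow, hrow]
  set v := (N * Nᵀ) *ᵥ Pi.single i 1
  have h1 : v ⬝ᵥ (F.hessian t *ᵥ ϑ) = α * Real.exp (-β * t) * (v ⬝ᵥ ϑ) := by
    rw [hessian_mulVec, dotProduct_add, dotProduct_mulVec_comm (F.Q_transpose ht),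
      F.Q_mulVec_eq_zero ht hv, zero_dotProduct, zero_add, dotProduct_smul, smul_eq_mul]
  rw [h, F.dotProduct_varphi hv ht] at h1
  exact (mul_left_cancel₀ ha h1).symm

/-- Once the held projector has settled, the error of the filtered projector is `e^{-γt}` times an
affine function of time (entrywise). -/
theorem P_entry_decay (hβ : 0 < β) (hγ : 0 < γ) (hδ : 0 < δ) (hφ : ContinuousOn φ (Ici 0))
    {q : ℕ} {T : ℝ} {Φa Φb : Matrix (Fin n) (Fin n) ℝ} (h : ExcitationBounds φ q T Φa Φb)
    (i j : Fin n) :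
    ∃ B C : ℝ, 0 ≤ C ∧ ∀ t, (⌈T / δ⌉₊ : ℝ) * δ ≤ t →
      |(F.P t - (1 - N * Nᵀ) : Matrix (Fin n) (Fin n) ℝ) i j|
        ≤ (B + C * t) * Real.exp (-γ * t) := by
  set t₀ : ℝ := (⌈T / δ⌉₊ : ℝ) * δ with ht₀
  have ht₀0 : 0 ≤ t₀ := by positivity
  have hTt₀ : T ≤ t₀ := by
    rw [ht₀, ← div_le_iff₀ hδ]; exact Nat.le_ceil _
  set p := (N * Nᵀ) i j with hp
  have hheld : ∀ τ, t₀ ≤ τ → heldProjector δ F.Nhat τ i j = p := by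
    intro τ hτ
    have hk : ⌈T / δ⌉₊ ≤ ⌊τ / δ⌋₊ := Nat.le_floor ((le_div_iff₀ hδ).2 hτ)
    have hT : T ≤ (⌊τ / δ⌋₊ : ℝ) * δ := by
      refine hTt₀.trans ?_
      rw [ht₀]; gcongr
    have hb := F.Nhat_basis ⌊τ / δ⌋₊
    rw [F.ker_Q hβ hφ h hT] at hb
    rw [heldProjector, hb.projector_unique hN]
  set I : ℝ → ℝ := fun t => ∫ τ in (0 : ℝ)..t, Real.exp (γ * τ) * heldProjector δ F.Nhat τ i j
    with hI
  -- after `t₀` the forcing of the scaled error is the constant `c`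
  set c : ℝ := γ * (p * Real.exp (γ * t₀) - γ * I t₀) with hc
  have hforce : ∀ t, t₀ ≤ t → γ * (p * Real.exp (γ * t) - γ * I t) = c := by
    intro t ht
    have hint := fun a b => intervalIntegrable_mul_heldProjector F.Nhat_basis (δ := δ)
      (f := fun τ => Real.exp (γ * τ)) (by fun_prop) i j a b
    have h1 : I t - I t₀ = ∫ τ in t₀..t, Real.exp (γ * τ) * heldProjector δ F.Nhat τ i j :=
      intervalIntegral.integral_interval_sub_left (hint 0 t) (hint 0 t₀)
    have h2 : ∫ τ in t₀..t, Real.exp (γ * τ) * heldProjector δ F.Nhat τ i j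
        = ∫ τ in t₀..t, Real.exp (γ * τ) * p := by
      refine intervalIntegral.integral_congr fun τ hτ => ?_
      rw [uIcc_of_le ht] at hτ
      simp only [hheld τ hτ.1]
    have h3 : ∫ τ in t₀..t, Real.exp (γ * τ) * p
        = Real.exp (γ * t) * (p / γ) - Real.exp (γ * t₀) * (p / γ) := by
      refine intervalIntegral.integral_eq_sub_of_hasDerivAt
        (f := fun τ => Real.exp (γ * τ) * (p / γ)) (fun τ _ => ?_)
        (Continuous.intervalIntegrable (by fun_prop) _ _)
      refine ((((hasDerivAt_id τ).const_mul γ).exp).mul_const (p / γ)).congr_deriv ?_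
      simp only [id]
      field_simp
    rw [h2, h3] at h1
    rw [hc, eq_add_of_sub_eq h1]
    field_simp
    ring
  -- the error scaled by `e^{γt}` has constant slope from `t₀` on
  set y : ℝ → ℝ := fun t =>
    Real.exp (γ * t) * (F.P t - (1 - N * Nᵀ) : Matrix (Fin n) (Fin n) ℝ) i j with hy
  have hyd : ∀ t, t₀ ≤ t → HasDerivWithinAt y c (Ici 0) t := by
    intro t ht
    have ht0 := ht₀0.trans ht
    have hd := (F.P_entry ht0 i j).sub_const ((1 - N * Nᵀ : Matrix (Fin n) (Fin n) ℝ) i j)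
    have hd2 : HasDerivWithinAt (fun s => (F.P s - (1 - N * Nᵀ) : Matrix (Fin n) (Fin n) ℝ) i j)
        (-γ * ((F.P t - (1 - N * Nᵀ) : Matrix (Fin n) (Fin n) ℝ) i j)
          + γ * (p - γ * (Real.exp (-γ * t) * I t)))
        (Ici 0) t := by
      refine hd.congr_deriv ?_
      rw [discounted_eq]
      simp only [Matrix.sub_apply, hI, hp]
      ring
    refine (hasDerivWithinAt_exp_mul hd2).congr_deriv ?_
    rw [← hforce t ht]
    have : Real.exp (γ * t) * Real.exp (-γ * t) = 1 := by rw [← Real.exp_add]; simp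
    linear_combination (-γ ^ 2 * I t) * this
  refine ⟨|y t₀|, |c|, abs_nonneg _, fun t ht => ?_⟩
  have hsub : Icc t₀ t ⊆ Ici 0 := fun u hu => ht₀0.trans hu.1
  have hmv := (convex_Icc t₀ t).norm_image_sub_le_of_norm_hasDerivWithin_le (f := y)
    (f' := fun _ => c) (C := |c|) (fun s hs => (hyd s hs.1).mono hsub) (fun _ _ => le_rfl)
    (left_mem_Icc.2 ht) (right_mem_Icc.2 ht)
  have hyt : |y t| ≤ |y t₀| + |c| * t := by
    rw [Real.norm_eq_abs, Real.norm_eq_abs, abs_of_nonneg (sub_nonneg.2 ht)] at hmv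
    have h1 := abs_sub_abs_le_abs_sub (y t) (y t₀)
    nlinarith [abs_nonneg c]
  have hE : Real.exp (γ * t) * Real.exp (-γ * t) = 1 := by rw [← Real.exp_add]; simp
  calc |(F.P t - (1 - N * Nᵀ) : Matrix (Fin n) (Fin n) ℝ) i j|
      = |y t| * Real.exp (-γ * t) := by
        rw [hy]; simp only [abs_mul, Real.abs_exp]
        linear_combination (-|(F.P t - (1 - N * Nᵀ) : Matrix (Fin n) (Fin n) ℝ) i j|) * hE
    _ ≤ _ := by gcongr

/-- The filtered projector converges to the projector onto the excited subspace at any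
exponential rate below `γ`. -/
theorem exists_P_decay (hβ : 0 < β) (hγ : 0 < γ) (hδ : 0 < δ) (hφ : ContinuousOn φ (Ici 0))
    {q : ℕ} {T : ℝ} {Φa Φb : Matrix (Fin n) (Fin n) ℝ} (h : ExcitationBounds φ q T Φa Φb)
    {ρ : ℝ} (hρ : ρ < γ) :
    ∃ t₀ K : ℝ, T ≤ t₀ ∧ ∀ t, t₀ ≤ t → ‖F.P t - (1 - N * Nᵀ)‖ ≤ K * Real.exp (-ρ * t) := by
  have hTt₀ : T ≤ (⌈T / δ⌉₊ : ℝ) * δ := by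
    rw [← div_le_iff₀ hδ]; exact Nat.le_ceil _
  suffices hent : ∀ i j, ∃ C, ∀ t ∈ Ici ((⌈T / δ⌉₊ : ℝ) * δ),
      |(F.P t - (1 - N * Nᵀ) : Matrix (Fin n) (Fin n) ℝ) i j| ≤ C * Real.exp (-ρ * t) by
    obtain ⟨K, hK⟩ := exists_norm_le_of_entries hent
    exact ⟨_, K, hTt₀, hK⟩
  intro i j
  obtain ⟨B, C, hC, hBC⟩ := F.P_entry_decay hN hβ hγ hδ hφ h i j
  refine ⟨|B| + C / (γ - ρ), fun t ht => (hBC t ht).trans ?_⟩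
  have ht0 : 0 ≤ t := h.T_pos.le.trans (hTt₀.trans ht)
  have hd : 0 < γ - ρ := sub_pos.2 hρ
  have h1 : Real.exp (-ρ * t) = Real.exp ((γ - ρ) * t) * Real.exp (-γ * t) := by
    rw [← Real.exp_add]; ring_nf
  rw [h1, ← mul_assoc]
  refine mul_le_mul_of_nonneg_right ?_ (Real.exp_pos _).le
  have h2 : (γ - ρ) * t + 1 ≤ Real.exp ((γ - ρ) * t) := Real.add_one_le_exp _
  have h3 : 1 ≤ Real.exp ((γ - ρ) * t) := by nlinarith [mul_nonneg hd.le ht0]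
  have h4 : C * t ≤ C / (γ - ρ) * Real.exp ((γ - ρ) * t) := by
    calc C * t = C / (γ - ρ) * ((γ - ρ) * t) := by field_simp
      _ ≤ _ := by gcongr; linarith
  have h5 : B ≤ |B| * Real.exp ((γ - ρ) * t) :=
    (le_abs_self B).trans (le_mul_of_one_le_right (abs_nonneg B) h3)
  linarith

end limit

end FilterRun

/-! ### Uniform coercivity and convergence -/

theorem eucl_mulVec_le (A : Matrix (Fin n) (Fin n) ℝ) (v : Fin n → ℝ) :
    eucl (A *ᵥ v) ≤ Real.sqrt n * ‖A‖ * eucl v := by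
  calc eucl (A *ᵥ v) ≤ Real.sqrt n * ‖A *ᵥ v‖ := eucl_le_norm _
    _ ≤ Real.sqrt n * (‖A‖ * ‖v‖) := by gcongr; exact Matrix.linfty_opNorm_mulVec A v
    _ ≤ Real.sqrt n * (‖A‖ * eucl v) := by gcongr; exact norm_le_eucl v
    _ = _ := by ring

/-- Coercivity survives perturbations that are small in norm. -/
theorem coercive_of_norm_sub_le {A B : Matrix (Fin n) (Fin n) ℝ} {c : ℝ}
    (hB : ∀ v : Fin n → ℝ, c * (v ⬝ᵥ v) ≤ v ⬝ᵥ (B *ᵥ v))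
    (h : Real.sqrt n * ‖A - B‖ ≤ c / 2) (v : Fin n → ℝ) :
    c / 2 * (v ⬝ᵥ v) ≤ v ⬝ᵥ (A *ᵥ v) := by
  have h1 := (neg_le_abs _).trans (abs_dotProduct_le v ((A - B) *ᵥ v))
  have h2 : eucl v * eucl ((A - B) *ᵥ v) ≤ c / 2 * (v ⬝ᵥ v) := by
    rw [← eucl_sq]
    calc eucl v * eucl ((A - B) *ᵥ v) ≤ eucl v * (Real.sqrt n * ‖A - B‖ * eucl v) := by
          gcongr; exacts [eucl_nonneg v, eucl_mulVec_le _ _]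
      _ = Real.sqrt n * ‖A - B‖ * eucl v ^ 2 := by ring
      _ ≤ _ := by gcongr
  rw [Matrix.sub_mulVec, dotProduct_sub] at h1
  rw [Matrix.sub_mulVec] at h2
  linarith [hB v]

section excitation

variable {q : ℕ} {T : ℝ} {Φa Φb : Matrix (Fin n) (Fin n) ℝ} (hφ : ContinuousOn φ (Ici 0))
  (h : ExcitationBounds φ q T Φa Φb) {m : ℕ} {N : Matrix (Fin n) (Fin m) ℝ}
  (hN : IsOrthonormalBasisOf N (unexcited φ))
include hφ h hN

/-- The excitation bound and the projector onto its kernel together control all directions. -/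
theorem ExcitationBounds.exists_coercive {μ : ℝ} (hμ : 0 < μ) (hκ : 0 < κ) :
    ∃ c : ℝ, 0 < c ∧ ∀ v : Fin n → ℝ, c * (v ⬝ᵥ v) ≤ v ⬝ᵥ ((μ • Φa + κ • (N * Nᵀ)) *ᵥ v) := by
  refine ParamLearning.exists_coercive fun v hv => ?_
  simp only [Matrix.add_mulVec, Matrix.smul_mulVec, dotProduct_add, dotProduct_smul, smul_eq_mul]
  have h1 := posSemidef_dotProduct_nonneg h.posSemidef_a v
  have h2 := mul_nonneg hκ.le (dotProduct_projector_nonneg N v)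
  rcases h1.eq_or_lt with h0 | h0
  · have hmem : v ∈ unexcited φ := by
      rw [← h.ker_eq hφ]
      exact posSemidef_mulVec_eq_zero h.posSemidef_a h0.ge
    rw [hN.mulVec_of_mem hmem, ← h0]
    have h4 : 0 < v ⬝ᵥ v :=
      (real_dotProduct_self_nonneg v).lt_of_ne' (fun h => hv (dotProduct_self_eq_zero.1 h))
    have := mul_pos hκ h4
    linarith
  · have := mul_pos hμ h0
    linarith

theorem ExcitationBounds.mul_projector : Φa * (N * Nᵀ) = 0 := by
  refine Matrix.ext_of_mulVec_single fun i => ?_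
  have := hN.mulVec_mem (Pi.single i 1)
  rw [← h.ker_eq hφ] at this
  rw [← Matrix.mulVec_mulVec, Matrix.zero_mulVec]
  exact this

theorem ExcitationBounds.projector_mul : (N * Nᵀ) * Φa = 0 := by
  have hs : Φaᵀ = Φa := h.posSemidef_a.1
  have := congrArg Matrix.transpose (h.mul_projector hφ hN)
  rwa [Matrix.transpose_mul, transpose_mul_transpose_self, hs, Matrix.transpose_zero] at this

namespace FilterRun

variable (F : FilterRun α β γ δ θ₀ φ z)

/-- Information matrix and projector onto the unexcited subspace together are coercive, uniformly
in time. -/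
theorem exists_Q_coercive (hβ : 0 < β) (hκ : 0 < κ) :
    ∃ c : ℝ, 0 < c ∧ ∀ t, T ≤ t → ∀ v : Fin n → ℝ,
      c * (v ⬝ᵥ v) ≤ v ⬝ᵥ ((F.Q t + κ • (N * Nᵀ)) *ᵥ v) := by
  obtain ⟨c, hc, hcv⟩ := h.exists_coercive hφ hN (Real.exp_pos (-β * T)) hκ
  refine ⟨c, hc, fun t ht v => (hcv v).trans ?_⟩
  simp only [Matrix.add_mulVec, Matrix.smul_mulVec, dotProduct_add, dotProduct_smul, smul_eq_mul]
  linarith [F.Q_lower hβ hφ h ht v]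

theorem tendsto_P (hβ : 0 < β) (hγ : 0 < γ) (hδ : 0 < δ) :
    Tendsto F.P atTop (𝓝 (1 - N * Nᵀ)) := by
  obtain ⟨t₀, K, -, hK⟩ := F.exists_P_decay hN hβ hγ hδ hφ h (half_lt_self hγ)
  refine tendsto_iff_norm_sub_tendsto_zero.2 (squeeze_zero'
    (Eventually.of_forall fun _ => norm_nonneg _)
    (eventually_atTop.2 ⟨t₀, hK⟩) ?_)
  have : Tendsto (fun t : ℝ => -(γ / 2) * t) atTop atBot :=
    tendsto_id.const_mul_atTop_of_neg (by linarith)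
  simpa using (Real.tendsto_exp_atBot.comp this).const_mul K

/-- The inverse gain is uniformly coercive for large times: it dominates
`e^{-βT} P Φa P + κ (1 - P)`, which tends to a positive definite matrix. -/
theorem exists_gainInv_coercive (hα : 0 < α) (hβ : 0 < β) (hγ : 0 < γ) (hδ : 0 < δ)
    (hκ : 0 < κ) :
    ∃ t₁ c : ℝ, 0 < c ∧ ∀ t, t₁ ≤ t → ∀ v : Fin n → ℝ,
      c * (v ⬝ᵥ v) ≤ v ⬝ᵥ (F.gainInv κ t *ᵥ v) := by
  set μ := Real.exp (-β * T) with hμ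
  obtain ⟨c, hc, hcv⟩ := h.exists_coercive hφ hN (Real.exp_pos (-β * T)) hκ
  set S : ℝ → Matrix (Fin n) (Fin n) ℝ := fun t => F.P t * (μ • Φa) * F.P t + κ • (1 - F.P t)
  have hlim : Tendsto S atTop (𝓝 (μ • Φa + κ • (N * Nᵀ))) := by
    have hP := F.tendsto_P hφ h hN hβ hγ hδ
    have := ((hP.mul_const (μ • Φa)).mul hP).add ((hP.const_sub 1).const_smul κ)
    convert this using 2
    rw [sub_sub_cancel, sub_mul, one_mul, Matrix.mul_smul, h.projector_mul hφ hN, smul_zero,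
      sub_zero, mul_sub, mul_one, Matrix.smul_mul, h.mul_projector hφ hN, smul_zero, sub_zero]
  have hlim2 : Tendsto (fun t => Real.sqrt n * ‖S t - (μ • Φa + κ • (N * Nᵀ))‖) atTop (𝓝 0) := by
    simpa using (tendsto_iff_norm_sub_tendsto_zero.1 hlim).const_mul (Real.sqrt n)
  obtain ⟨t₁, ht₁⟩ := eventually_atTop.1 (hlim2.eventually_le_const (half_pos hc))
  refine ⟨max t₁ T, c / 2, half_pos hc, fun t ht v => ?_⟩
  have htT : T ≤ t := (le_max_right _ _).trans ht
  have ht0 : 0 ≤ t := h.T_pos.le.trans htT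
  refine (coercive_of_norm_sub_le hcv (ht₁ t ((le_max_left _ _).trans ht)) v).trans ?_
  rw [F.gainInv_quadForm ht0]
  have h1 := F.Q_lower hβ hφ h htT (F.P t *ᵥ v)
  have h2 := F.P_nonneg hγ ht0 v
  have h3 : 0 < α * Real.exp (-β * t) := by positivity
  have h4 : v ⬝ᵥ (S t *ᵥ v) = μ * ((F.P t *ᵥ v) ⬝ᵥ (Φa *ᵥ (F.P t *ᵥ v)))
      + κ * (v ⬝ᵥ v - v ⬝ᵥ (F.P t *ᵥ v)) := by
    rw [← dotProduct_mulVec_comm (F.P_transpose ht0)]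
    simp only [S, Matrix.add_mulVec, Matrix.smul_mulVec, Matrix.sub_mulVec, dotProduct_add,
      dotProduct_smul, dotProduct_sub, Matrix.one_mulVec, smul_eq_mul, Matrix.mulVec_mulVec,
      Matrix.mul_assoc, Matrix.mul_smul, Matrix.smul_mul]
  rw [h4]
  have := mul_nonneg h3.le h2
  linarith

/-- The least squares solutions stay bounded. -/
theorem exists_leastSquares_bound (hα : 0 < α) (hβ : 0 < β)
    (hv : ∃ C : ℝ, ∀ t, 0 ≤ t → eucl (F.varphi t) ≤ C) :
    ∃ C : ℝ, ∀ t, T ≤ t → ∀ ϑ, F.hessian t *ᵥ ϑ = F.varphi t → eucl ϑ ≤ C := by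
  obtain ⟨C, hC⟩ := hv
  obtain ⟨c, hc, hcv⟩ := F.exists_Q_coercive hφ h hN hβ one_pos
  refine ⟨(C + eucl ((N * Nᵀ) *ᵥ θ₀)) / c, fun t ht ϑ hϑ => ?_⟩
  have ht0 : 0 ≤ t := h.T_pos.le.trans ht
  set A := F.Q t + (1 : ℝ) • (N * Nᵀ) + (α * Real.exp (-β * t)) • (1 : Matrix (Fin n) (Fin n) ℝ)
    with hA
  have h1 : A *ᵥ ϑ = F.varphi t + (N * Nᵀ) *ᵥ θ₀ := by
    rw [← F.projector_mulVec_leastSquares hN hα ht0 hϑ, ← hϑ, hA, hessian]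
    simp only [Matrix.add_mulVec, one_smul]
    abel
  have h2 : c * (ϑ ⬝ᵥ ϑ) ≤ ϑ ⬝ᵥ (A *ᵥ ϑ) := by
    refine (hcv t ht ϑ).trans ?_
    have h3 : A *ᵥ ϑ = (F.Q t + (1 : ℝ) • (N * Nᵀ)) *ᵥ ϑ + (α * Real.exp (-β * t)) • ϑ := by
      rw [hA, Matrix.add_mulVec, Matrix.smul_mulVec, Matrix.one_mulVec]
    rw [h3, dotProduct_add, dotProduct_smul, smul_eq_mul]
    have := mul_nonneg (by positivity : 0 ≤ α * Real.exp (-β * t)) (real_dotProduct_self_nonneg ϑ)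
    linarith
  refine (eucl_le_of_coercive hc h2).trans ?_
  rw [h1]
  gcongr
  exact (eucl_add_le _ _).trans (by gcongr; exact hC t ht0)

/-- On the excited subspace the least squares solution for noise-free data approaches the true
parameter at the forgetting rate. -/
theorem exists_noise_free_decay (hα : 0 < α) (hβ : 0 < β) {θ : Fin n → ℝ}
    (hz : ∀ t : ℝ, 0 ≤ t → z t = φ t ⬝ᵥ θ) :
    ∃ C : ℝ, ∀ t, 0 ≤ t → ∀ ϑ, F.hessian t *ᵥ ϑ = F.varphi t →
      eucl ((1 - N * Nᵀ) *ᵥ (ϑ - θ)) ≤ C * Real.exp (-β * t) := by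
  obtain ⟨c, hc, hcv⟩ := F.exists_Q_coercive hφ h hN hβ one_pos
  set C₁ := Real.sqrt n * ‖(1 : Matrix (Fin n) (Fin n) ℝ) - N * Nᵀ‖ * eucl (θ₀ - θ)
  have hC₁ : 0 ≤ C₁ := mul_nonneg (by positivity) (eucl_nonneg _)
  set C₂ := α * eucl ((1 - N * Nᵀ) *ᵥ (θ₀ - θ)) / c
  have hC₂ : 0 ≤ C₂ := div_nonneg (mul_nonneg hα.le (eucl_nonneg _)) hc.le
  refine ⟨C₁ * Real.exp (β * T) + C₂, fun t ht0 ϑ hϑ => ?_⟩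
  set a := α * Real.exp (-β * t) with ha
  have ha0 : 0 < a := by positivity
  have hnorm : F.Q t *ᵥ (ϑ - θ) + a • (ϑ - θ) = a • (θ₀ - θ) := by
    rw [F.varphi_eq_of_noise_free hz ht0, hessian_mulVec] at hϑ
    rw [Matrix.mulVec_sub, smul_sub, smul_sub, eq_sub_of_add_eq hϑ]
    abel
  have hsm : ∀ x : Fin n → ℝ, eucl (a • x) = a * eucl x := fun x => by
    unfold eucl; rw [WithLp.toLp_smul, norm_smul, Real.norm_eq_abs, abs_of_pos ha0]
  rw [add_mul]
  -- before `T` the Hessian is only bounded below by the regularization, which suffices here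
  rcases le_total t T with ht | ht
  · refine le_add_of_le_of_nonneg ?_ (mul_nonneg hC₂ (Real.exp_pos _).le)
    have h1 := eucl_le_of_coercive ha0 (F.hessian_coercive ht0 (ϑ - θ))
    rw [hessian_mulVec, hnorm, hsm, mul_div_cancel_left₀ _ ha0.ne'] at h1
    have h2 : 1 ≤ Real.exp (β * T) * Real.exp (-β * t) := by
      rw [← Real.exp_add]
      exact Real.one_le_exp (by nlinarith)
    calc _ ≤ C₁ * 1 := by
          rw [mul_one]
          exact (eucl_mulVec_le _ _).trans (mul_le_mul_of_nonneg_left h1 (by positivity))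
      _ ≤ C₁ * (Real.exp (β * T) * Real.exp (-β * t)) := by gcongr
      _ = _ := by ring
  refine le_add_of_nonneg_of_le (by positivity) ?_
  set w := (1 - N * Nᵀ) *ᵥ (ϑ - θ) with hw
  have hQw : F.Q t *ᵥ w = F.Q t *ᵥ (ϑ - θ) := by
    rw [hw, Matrix.mulVec_mulVec, mul_sub, mul_one, F.Q_mul_projector hN ht0, sub_zero]
  have hQw' : (1 - N * Nᵀ) *ᵥ (F.Q t *ᵥ (ϑ - θ)) = F.Q t *ᵥ (ϑ - θ) := by
    rw [Matrix.mulVec_mulVec, sub_mul, one_mul, F.projector_mul_Q hN ht0, sub_zero]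
  have hNw : (N * Nᵀ) *ᵥ w = 0 := by
    rw [hw, Matrix.mulVec_mulVec, mul_sub, mul_one, hN.mul_self, sub_self, Matrix.zero_mulVec]
  set A := F.Q t + (1 : ℝ) • (N * Nᵀ) + a • (1 : Matrix (Fin n) (Fin n) ℝ) with hA
  have h1 : A *ᵥ w = a • ((1 - N * Nᵀ) *ᵥ (θ₀ - θ)) := by
    rw [← Matrix.mulVec_smul, ← hnorm, Matrix.mulVec_add, Matrix.mulVec_smul, hQw', ← hw, hA]
    simp only [Matrix.add_mulVec, one_smul, hQw, hNw, Matrix.smul_mulVec, Matrix.one_mulVec,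
      add_zero]
  have h2 : c * (w ⬝ᵥ w) ≤ w ⬝ᵥ (A *ᵥ w) := by
    refine (hcv t ht w).trans ?_
    have h3 : A *ᵥ w = (F.Q t + (1 : ℝ) • (N * Nᵀ)) *ᵥ w + a • w := by
      rw [hA, Matrix.add_mulVec, Matrix.smul_mulVec, Matrix.one_mulVec]
    rw [h3, dotProduct_add, dotProduct_smul, smul_eq_mul]
    have := mul_nonneg ha0.le (real_dotProduct_self_nonneg w)
    linarith
  refine (eucl_le_of_coercive hc h2).trans (le_of_eq ?_)
  rw [h1, hsm]
  simp only [C₂, ha]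
  ring

end FilterRun

end excitation

namespace EstimatorRun

variable (E : EstimatorRun α β γ δ κ θ₀ φ z)

/-- The estimation error, premultiplied by the inverse gain, is linear in the error `G` of the
filtered projector. -/
theorem gainInv_mulVec_error (hα : 0 < α) (hκ : 0 < κ) (hφ : ContinuousOn φ (Ici 0)) {m : ℕ}
    {N : Matrix (Fin n) (Fin m) ℝ} (hN : IsOrthonormalBasisOf N (unexcited φ)) {t : ℝ}
    (ht : 0 ≤ t) {ϑ : Fin n → ℝ} (hϑ : E.toFilterRun.hessian t *ᵥ ϑ = E.varphi t)
    {G : Matrix (Fin n) (Fin n) ℝ} (hG : G = E.P t - (1 - N * Nᵀ)) :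
    E.toFilterRun.gainInv κ t *ᵥ (E.θhat t - ϑ)
      = (κ • G - E.P t * E.Q t * G) *ᵥ ϑ
        + ((E.P t * E.Q t + (α * Real.exp (-β * t) - κ) • 1) * (G * (N * Nᵀ) - E.P t * G)
          - κ • G) *ᵥ θ₀ := by
  set a := α * Real.exp (-β * t) with ha
  set S := N * Nᵀ with hS
  set P := E.P t with hP
  set Q := E.Q t with hQ
  have hPG : P = 1 - S + G := by rw [hG]; abel
  have hSS : S * S = S := hN.mul_self
  have hQS : Q * S = 0 := E.toFilterRun.Q_mul_projector hN ht
  have hSϑ : S *ᵥ ϑ = S *ᵥ θ₀ := E.toFilterRun.projector_mulVec_leastSquares hN hα ht hϑ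
  have hM : E.toFilterRun.gainInv κ t = P * Q * P + a • P + κ • (1 - P) := rfl
  have hH : E.toFilterRun.hessian t = Q + a • 1 := rfl
  have h1P : 1 - P = S - G := by rw [hPG]; abel
  have hPS : P * S = G * S := by rw [hPG, add_mul, sub_mul, one_mul, hSS, sub_self, zero_add]
  have hPP : P * (1 - P) = G * S - P * G := by rw [h1P, mul_sub, hPS]
  have hsq : (1 - P) * (1 - P) = S - G - (G * S - P * G) := by
    rw [sub_mul, one_mul, hPP, h1P]
  have e1 : E.toFilterRun.gainInv κ t *ᵥ E.θd t = (P * (Q + a • 1)) *ᵥ ϑ := by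
    rw [E.gainInv_mulVec_θd hφ hκ ht, ← hϑ, Matrix.mulVec_mulVec, hH]
  have e2 : P * (Q + a • 1) - E.toFilterRun.gainInv κ t
      = -(P * Q * G) - κ • (S - G) := by
    have : P * Q * P = P * Q - P * Q * (1 - P) := by rw [mul_sub, mul_one, sub_sub_cancel]
    rw [hM, this, h1P, mul_sub, Matrix.mul_assoc P Q S, hQS, mul_zero, mul_add,
      Matrix.mul_smul, mul_one]
    abel
  have e3 : E.toFilterRun.gainInv κ t * (1 - P)
      = (P * Q + a • 1) * (G * S - P * G) + κ • (S - G - (G * S - P * G)) := by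
    rw [hM, add_mul, add_mul, Matrix.smul_mul, Matrix.smul_mul, hsq, Matrix.mul_assoc (P * Q), hPP,
      add_mul, Matrix.smul_mul, one_mul]
  calc E.toFilterRun.gainInv κ t *ᵥ (E.θhat t - ϑ)
      = (P * (Q + a • 1) - E.toFilterRun.gainInv κ t) *ᵥ ϑ
        + (E.toFilterRun.gainInv κ t * (1 - P)) *ᵥ θ₀ := by
        rw [θhat, Matrix.mulVec_sub, Matrix.mulVec_add, e1, Matrix.mulVec_mulVec, Matrix.sub_mulVec]
        abel
    _ = _ := by
        rw [e2, e3]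
        simp only [Matrix.add_mulVec, Matrix.sub_mulVec, Matrix.neg_mulVec, Matrix.smul_mulVec,
          add_mul, sub_smul, sub_mul, Matrix.smul_mul, one_mul, hSϑ, smul_sub]
        abel

theorem continuousOn_θhat : ContinuousOn E.θhat (Ici 0) := by
  intro t ht
  have h1 : HasMatrixDerivAt (fun s => 1 - E.P s) (-projectorRate γ δ E.Nhat E.P t) t :=
    hasMatrixDerivAt_iff.2 ((hasMatrixDerivAt_iff.1 (E.P_ode t ht)).const_sub 1)
  exact ((E.θd_ode t ht).continuousWithinAt).add
    (h1.mulVec (hasDerivWithinAt_const _ _ θ₀)).continuousWithinAt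

/-- Exponential convergence to the least squares solution at any rate below `γ`. -/
theorem exists_error_decay (hα : 0 < α) (hβ : 0 < β) (hγ : 0 < γ) (hδ : 0 < δ) (hκ : 0 < κ)
    (hφ : ContinuousOn φ (Ici 0)) (hφ_bdd : ∃ C : ℝ, ∀ t : ℝ, 0 ≤ t → eucl (φ t) ≤ C)
    (hz : ContinuousOn z (Ici 0)) (hz_bdd : ∃ C : ℝ, ∀ t : ℝ, 0 ≤ t → |z t| ≤ C) {q : ℕ}
    (hDE : DeficientExcitation φ q) {θstar : ℝ → Fin n → ℝ}
    (hstar : ∀ t : ℝ, 0 ≤ t → IsLeastSquares α β θ₀ φ z t (θstar t)) {ρ : ℝ} (hρ : ρ < γ) :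
    ∃ ρa : ℝ, 0 < ρa ∧ ∀ t : ℝ, 0 ≤ t →
      eucl (E.θhat t - θstar t) ≤ ρa * Real.exp (-ρ * t) := by
  obtain ⟨T, Φa, Φb, h⟩ := hDE
  obtain ⟨m, N, hN⟩ := exists_isOrthonormalBasisOf (unexcited φ)
  set F := E.toFilterRun with hF
  have hnormal : ∀ t, 0 ≤ t → F.hessian t *ᵥ θstar t = F.varphi t := fun t ht =>
    (F.isLeastSquares_iff hα hφ hz ht _).1 (hstar t ht)
  obtain ⟨Cv, hCv⟩ := F.exists_varphi_bound hβ hφ_bdd hz_bdd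
  obtain ⟨b, hb⟩ := F.exists_Q_bound hβ hφ_bdd
  obtain ⟨s, hs⟩ := F.exists_leastSquares_bound hφ h hN hα hβ ⟨Cv, hCv⟩
  obtain ⟨t₀, K, hTt₀, hK⟩ := F.exists_P_decay hN hβ hγ hδ hφ h hρ
  obtain ⟨t₁, c, hc, hcv⟩ := F.exists_gainInv_coercive hφ h hN hα hβ hγ hδ hκ
  obtain ⟨t₂, ht₂⟩ := eventually_atTop.1
    ((F.tendsto_P hφ h hN hβ hγ hδ).norm.eventually_le_const
      (lt_add_one ‖(1 : Matrix (Fin n) (Fin n) ℝ) - N * Nᵀ‖))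
  set p := ‖(1 : Matrix (Fin n) (Fin n) ℝ) - N * Nᵀ‖ + 1 with hp
  set τ := max (max t₀ t₁) (max t₂ 0) with hτ
  have hτ0 : 0 ≤ τ := (le_max_right _ _).trans (le_max_right _ _)
  have hp0 : 0 ≤ p := by positivity
  have hb0 : 0 ≤ b := (norm_nonneg _).trans (hb 0 le_rfl)
  have hs0 : 0 ≤ s := (eucl_nonneg _).trans (hs T le_rfl _ (hnormal T h.T_pos.le))
  -- large times: the error is controlled by the error of the filtered projector
  set X := (κ + p * b) * s + ((p * b + (α + κ)) * (‖N * Nᵀ‖ + p) + κ) * ‖θ₀‖ with hX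
  have hX0 : 0 ≤ X := by positivity
  have hlarge : ∀ t, τ ≤ t →
      eucl (E.θhat t - θstar t) ≤ Real.sqrt n * X * K / c * Real.exp (-ρ * t) := by
    intro t ht
    have ht0 : 0 ≤ t := hτ0.trans ht
    have htt₀ : t₀ ≤ t := ((le_max_left _ _).trans (le_max_left _ _)).trans ht
    have htt₁ : t₁ ≤ t := ((le_max_right _ _).trans (le_max_left _ _)).trans ht
    have htt₂ : t₂ ≤ t := ((le_max_left _ _).trans (le_max_right _ _)).trans ht
    obtain ⟨G, hG⟩ : ∃ G, G = E.P t - (1 - N * Nᵀ) := ⟨_, rfl⟩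
    have hGK : ‖G‖ ≤ K * Real.exp (-ρ * t) := by rw [hG]; exact hK t htt₀
    have hPp : ‖E.P t‖ ≤ p := ht₂ t htt₂
    have hQb : ‖E.Q t‖ ≤ b := hb t ht0
    have hPQ : ‖E.P t * E.Q t‖ ≤ p * b :=
      (norm_mul_le _ _).trans (mul_le_mul hPp hQb (norm_nonneg _) hp0)
    have hϑs : ‖θstar t‖ ≤ s := (norm_le_eucl _).trans
      (hs t (hTt₀.trans htt₀) _ (hnormal t ht0))
    have ha : |α * Real.exp (-β * t) - κ| ≤ α + κ := by
      have h1 : Real.exp (-β * t) ≤ 1 := Real.exp_le_one_iff.2 (by nlinarith)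
      have h2 := Real.exp_pos (-β * t)
      rw [abs_le]; constructor <;> nlinarith
    have hone : ‖(1 : Matrix (Fin n) (Fin n) ℝ)‖ ≤ 1 := by
      rcases isEmpty_or_nonempty (Fin n) with hn | hn
      · rw [Subsingleton.elim (1 : Matrix (Fin n) (Fin n) ℝ) 0, norm_zero]; exact zero_le_one
      · exact norm_one.le
    have hA : ‖κ • G - E.P t * E.Q t * G‖ ≤ (κ + p * b) * ‖G‖ := by
      refine (norm_sub_le _ _).trans ?_
      rw [norm_smul, Real.norm_eq_abs, abs_of_pos hκ, add_mul]
      gcongr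
      exact (norm_mul_le _ _).trans (by gcongr)
    have hB : ‖(E.P t * E.Q t + (α * Real.exp (-β * t) - κ) • 1) * (G * (N * Nᵀ) - E.P t * G)
          - κ • G‖ ≤ ((p * b + (α + κ)) * (‖N * Nᵀ‖ + p) + κ) * ‖G‖ := by
      have b1 : ‖E.P t * E.Q t + (α * Real.exp (-β * t) - κ) • (1 : Matrix (Fin n) (Fin n) ℝ)‖
          ≤ p * b + (α + κ) := by
        refine (norm_add_le _ _).trans (add_le_add hPQ ?_)
        rw [norm_smul, Real.norm_eq_abs]
        calc _ ≤ (α + κ) * 1 := by gcongr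
          _ = _ := mul_one _
      have b2 : ‖G * (N * Nᵀ) - E.P t * G‖ ≤ (‖N * Nᵀ‖ + p) * ‖G‖ := by
        refine (norm_sub_le _ _).trans ?_
        rw [add_mul, mul_comm ‖N * Nᵀ‖]
        exact add_le_add (norm_mul_le _ _) ((norm_mul_le _ _).trans (by gcongr))
      refine (norm_sub_le _ _).trans ?_
      rw [norm_smul, Real.norm_eq_abs, abs_of_pos hκ, add_mul _ κ, mul_assoc (p * b + (α + κ))]
      refine add_le_add ((norm_mul_le _ _).trans ?_) le_rfl
      exact mul_le_mul b1 b2 (norm_nonneg _) (by positivity)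
    have herr := E.gainInv_mulVec_error hα hκ hφ hN ht0 (hnormal t ht0) hG
    have hnorm : ‖E.toFilterRun.gainInv κ t *ᵥ (E.θhat t - θstar t)‖ ≤ X * ‖G‖ := by
      rw [herr]
      refine (norm_add_le _ _).trans ?_
      calc _ ≤ (κ + p * b) * ‖G‖ * s
            + ((p * b + (α + κ)) * (‖N * Nᵀ‖ + p) + κ) * ‖G‖ * ‖θ₀‖ := by
            refine add_le_add ((Matrix.linfty_opNorm_mulVec _ _).trans ?_)
              ((Matrix.linfty_opNorm_mulVec _ _).trans ?_)
            · exact mul_le_mul hA hϑs (norm_nonneg _) (by positivity)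
            · gcongr
        _ = _ := by rw [hX]; ring
    refine (eucl_le_of_coercive hc (hcv t htt₁ _)).trans ?_
    rw [div_mul_eq_mul_div]
    gcongr
    calc _ ≤ Real.sqrt n * (X * (K * Real.exp (-ρ * t))) :=
          (eucl_le_norm _).trans (by gcongr; exact hnorm.trans (by gcongr))
      _ = _ := by ring
  -- bounded times: both estimates are bounded
  obtain ⟨C₁, hC₁⟩ := (isCompact_Icc (a := (0 : ℝ)) (b := τ)).exists_bound_of_continuousOn
    (E.continuousOn_θhat.mono Icc_subset_Ici_self)
  have hsmall : ∀ t, 0 ≤ t → t ≤ τ → eucl (E.θhat t - θstar t)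
      ≤ Real.sqrt n * (C₁ + Cv / (α * Real.exp (-β * τ))) := by
    intro t ht0 ht
    refine (eucl_le_norm _).trans ?_
    gcongr
    refine (norm_sub_le _ _).trans (add_le_add (hC₁ t ⟨ht0, ht⟩) ((norm_le_eucl _).trans ?_))
    have h1 := eucl_le_of_coercive (by positivity) (F.hessian_coercive ht0 (θstar t))
    rw [hnormal t ht0] at h1
    refine h1.trans ?_
    have hCv0 : 0 ≤ Cv := (eucl_nonneg _).trans (hCv 0 le_rfl)
    refine div_le_div₀ hCv0 (hCv t ht0) (by positivity) ?_
    gcongr ?_ * Real.exp ?_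
    nlinarith
  set B := Real.sqrt n * (C₁ + Cv / (α * Real.exp (-β * τ)))
  set L := Real.sqrt n * X * K / c
  refine ⟨|L| + |B| * Real.exp (|ρ| * τ) + 1, by positivity, fun t ht => ?_⟩
  rcases le_total τ t with h1 | h1
  · refine (hlarge t h1).trans (mul_le_mul_of_nonneg_right ?_ (Real.exp_pos _).le)
    have := mul_nonneg (abs_nonneg B) (Real.exp_pos (|ρ| * τ)).le
    linarith [le_abs_self L]
  · have h2 : 1 ≤ Real.exp (|ρ| * τ) * Real.exp (-ρ * t) := by
      rw [← Real.exp_add]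
      refine Real.one_le_exp ?_
      have h3 := mul_le_mul (le_abs_self ρ) h1 ht (abs_nonneg ρ)
      linarith
    calc eucl (E.θhat t - θstar t) ≤ |B| * 1 := by
          rw [mul_one]; exact (hsmall t ht h1).trans (le_abs_self _)
      _ ≤ |B| * (Real.exp (|ρ| * τ) * Real.exp (-ρ * t)) := by gcongr
      _ ≤ _ := by
          have := mul_nonneg (abs_nonneg L) (Real.exp_pos (-ρ * t)).le
          nlinarith [Real.exp_pos (-ρ * t)]

end EstimatorRun

/-- Coordinates along an orthonormal basis of the identifiable subspace do not see the unexcited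
directions, and do not increase the norm. -/
theorem eucl_transpose_mulVec_le {q k : ℕ} {T : ℝ} {Φa Φb : Matrix (Fin n) (Fin n) ℝ}
    (hφ : ContinuousOn φ (Ici 0)) (h : ExcitationBounds φ q T Φa Φb) {m : ℕ}
    {N : Matrix (Fin n) (Fin m) ℝ} (hN : IsOrthonormalBasisOf N (unexcited φ))
    {Nd : Matrix (Fin n) (Fin k) ℝ} (hNd : IsOrthonormalBasisOf Nd (LinearMap.range Φa.mulVecLin))
    (v : Fin n → ℝ) : eucl (Ndᵀ *ᵥ v) ≤ eucl ((1 - N * Nᵀ) *ᵥ v) := by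
  have hzero : Ndᵀ * (N * Nᵀ) = 0 := by
    have h1 : (N * Nᵀ) * Nd = 0 := by
      refine Matrix.ext_of_mulVec_single fun i => ?_
      have hmem : Nd *ᵥ Pi.single i 1 ∈ LinearMap.range Φa.mulVecLin := by
        rw [← hNd.2]; exact ⟨_, rfl⟩
      obtain ⟨w, hw⟩ := hmem
      rw [← Matrix.mulVec_mulVec, ← hw, Matrix.mulVecLin_apply, Matrix.mulVec_mulVec,
        h.projector_mul hφ hN, Matrix.zero_mulVec, Matrix.zero_mulVec]
    have := congrArg Matrix.transpose h1
    rwa [Matrix.transpose_mul, transpose_mul_transpose_self, Matrix.transpose_zero] at this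
  have heq : Ndᵀ *ᵥ v = Ndᵀ *ᵥ ((1 - N * Nᵀ) *ᵥ v) := by
    rw [Matrix.mulVec_mulVec, Matrix.mul_sub, Matrix.mul_one, hzero, sub_zero]
  rw [heq]
  refine (sq_le_sq₀ (eucl_nonneg _) (eucl_nonneg _)).1 ?_
  rw [eucl_sq, eucl_sq, ← dotProduct_projector]
  exact hNd.dotProduct_projector_le _

/-- For noise-free data the identifiable components of the estimate converge to the true ones. -/
theorem EstimatorRun.exists_identifiable_decay (E : EstimatorRun α β γ δ κ θ₀ φ z) (hα : 0 < α)
    (hβ : 0 < β) (hδ : 0 < δ) (hκ : 0 < κ) (hφ : ContinuousOn φ (Ici 0))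
    (hφ_bdd : ∃ C : ℝ, ∀ t : ℝ, 0 ≤ t → eucl (φ t) ≤ C) (hz : ContinuousOn z (Ici 0))
    {θ : Fin n → ℝ} (hzθ : ∀ t : ℝ, 0 ≤ t → z t = φ t ⬝ᵥ θ) {q k : ℕ} {T : ℝ}
    {Φa Φb : Matrix (Fin n) (Fin n) ℝ} (h : ExcitationBounds φ q T Φa Φb)
    {Nd : Matrix (Fin n) (Fin k) ℝ} (hNd : IsOrthonormalBasisOf Nd (LinearMap.range Φa.mulVecLin))
    (hγ : β / 2 < γ) :
    ∃ ρc : ℝ, 0 < ρc ∧ ∀ t : ℝ, 0 ≤ t →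
      eucl (Ndᵀ *ᵥ (E.θhat t - θ)) ≤ ρc * Real.exp (-(β / 2) * t) := by
  obtain ⟨m, N, hN⟩ := exists_isOrthonormalBasisOf (unexcited φ)
  have hz_bdd : ∃ C : ℝ, ∀ t : ℝ, 0 ≤ t → |z t| ≤ C := by
    obtain ⟨C, hC⟩ := hφ_bdd
    refine ⟨C * eucl θ, fun t ht => ?_⟩
    rw [hzθ t ht]
    exact (abs_dotProduct_le _ _).trans (mul_le_mul_of_nonneg_right (hC t ht) (eucl_nonneg _))
  have hex : ∀ t : ℝ, ∃ ϑ : Fin n → ℝ, 0 ≤ t → IsLeastSquares α β θ₀ φ z t ϑ := fun t => by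
    by_cases ht : 0 ≤ t
    · obtain ⟨ϑ, hϑ, -⟩ := E.toFilterRun.existsUnique_isLeastSquares hα hφ hz ht
      exact ⟨ϑ, fun _ => hϑ⟩
    · exact ⟨0, fun h => absurd h ht⟩
  choose θstar hstar using hex
  obtain ⟨A, hA, hAt⟩ := E.exists_error_decay hα hβ ((half_pos hβ).trans hγ) hδ hκ hφ hφ_bdd hz
    hz_bdd ⟨T, Φa, Φb, h⟩ hstar hγ
  obtain ⟨C, hC⟩ := E.toFilterRun.exists_noise_free_decay hφ h hN hα hβ hzθ
  set B := Real.sqrt n * ‖(1 : Matrix (Fin n) (Fin n) ℝ) - N * Nᵀ‖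
  refine ⟨B * A + |C| + 1, by positivity, fun t ht => ?_⟩
  have h1 := hC t ht (θstar t)
    ((E.toFilterRun.isLeastSquares_iff hα hφ hz ht _).1 (hstar t ht))
  have h2 : Real.exp (-β * t) ≤ Real.exp (-(β / 2) * t) :=
    Real.exp_le_exp.2 (by nlinarith)
  have h3 : C * Real.exp (-β * t) ≤ |C| * Real.exp (-(β / 2) * t) :=
    mul_le_mul (le_abs_self C) h2 (Real.exp_pos _).le (abs_nonneg C)
  have h4 : eucl ((1 - N * Nᵀ) *ᵥ (E.θhat t - θstar t)) ≤ B * (A * Real.exp (-(β / 2) * t)) :=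
    (eucl_mulVec_le _ _).trans (mul_le_mul_of_nonneg_left (hAt t ht) (by positivity))
  calc eucl (Ndᵀ *ᵥ (E.θhat t - θ)) ≤ eucl ((1 - N * Nᵀ) *ᵥ (E.θhat t - θ)) :=
        eucl_transpose_mulVec_le hφ h hN hNd _
    _ ≤ eucl ((1 - N * Nᵀ) *ᵥ (E.θhat t - θstar t)) + eucl ((1 - N * Nᵀ) *ᵥ (θstar t - θ)) := by
        rw [← sub_add_sub_cancel (E.θhat t) (θstar t) θ, Matrix.mulVec_add]
        exact eucl_add_le _ _
    _ ≤ _ := by nlinarith [Real.exp_pos (-(β / 2) * t)]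

end ParamLearning

theorem theorem2 {n q : ℕ} (α β δ κ : ℝ) (hα : 0 < α) (hβ : 0 < β) (hδ : 0 < δ) (hκ : 0 < κ)
    (θ θ₀ : Fin n → ℝ) (φ : ℝ → Fin n → ℝ) (ε z : ℝ → ℝ)
    (hφ_cont : ContinuousOn φ (Ici 0)) (hφ_bdd : ∃ C : ℝ, ∀ t : ℝ, 0 ≤ t → eucl (φ t) ≤ C)
    (hε_bdd : ∃ C : ℝ, ∀ t : ℝ, 0 ≤ t → |ε t| ≤ C)
    (hz_cont : ContinuousOn z (Ici 0))
    (hz : ∀ t : ℝ, 0 ≤ t → z t = φ t ⬝ᵥ θ + ε t)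
    (hDE : DeficientExcitation φ q) :
    -- the least-squares solution is well defined at every time
    (∀ t : ℝ, 0 ≤ t → ∃! ϑ : Fin n → ℝ, IsLeastSquares α β θ₀ φ z t ϑ) ∧
    -- the algorithm has a solution on `[0, ∞)`
    (∀ γ : ℝ, 0 < γ → Nonempty (EstimatorRun α β γ δ κ θ₀ φ z)) ∧
    -- exponential convergence to the least-squares solution
    (∀ γ : ℝ, 0 < γ → ∀ E : EstimatorRun α β γ δ κ θ₀ φ z, ∀ θstar : ℝ → Fin n → ℝ,
      (∀ t : ℝ, 0 ≤ t → IsLeastSquares α β θ₀ φ z t (θstar t)) →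
      ∃ ρa ρb : ℝ, 0 < ρa ∧ 0 < ρb ∧ ∀ t : ℝ, 0 ≤ t →
        eucl (E.θhat t - θstar t) ≤ ρa * Real.exp (-ρb * t)) ∧
    -- the rate can be made arbitrarily fast by increasing `γ`
    (∀ ρb : ℝ, 0 < ρb → ∃ γ₀ : ℝ, 0 < γ₀ ∧ ∀ γ : ℝ, γ₀ < γ →
      ∀ E : EstimatorRun α β γ δ κ θ₀ φ z, ∀ θstar : ℝ → Fin n → ℝ,
      (∀ t : ℝ, 0 ≤ t → IsLeastSquares α β θ₀ φ z t (θstar t)) →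
      ∃ ρa : ℝ, 0 < ρa ∧ ∀ t : ℝ, 0 ≤ t →
        eucl (E.θhat t - θstar t) ≤ ρa * Real.exp (-ρb * t)) ∧
    -- noise-free case: convergence to the true parameter on the identifiable subspace
    ((∀ t : ℝ, 0 ≤ t → ε t = 0) →
      ∀ (T : ℝ) (Φa Φb : Matrix (Fin n) (Fin n) ℝ), ExcitationBounds φ q T Φa Φb →
      ∀ Nd : Matrix (Fin n) (Fin (n - q)) ℝ,
        IsOrthonormalBasisOf Nd (LinearMap.range Φa.mulVecLin) →
      ∀ γ : ℝ, β / 2 < γ → ∀ E : EstimatorRun α β γ δ κ θ₀ φ z,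
      ∃ ρc : ℝ, 0 < ρc ∧ ∀ t : ℝ, 0 ≤ t →
        eucl (Ndᵀ *ᵥ (E.θhat t - θ)) ≤ ρc * Real.exp (-(β / 2) * t)) := by
  have hz_bdd : ∃ C : ℝ, ∀ t : ℝ, 0 ≤ t → |z t| ≤ C := by
    obtain ⟨C, hC⟩ := hφ_bdd
    obtain ⟨D, hD⟩ := hε_bdd
    refine ⟨C * eucl θ + D, fun t ht => ?_⟩
    rw [hz t ht]
    refine (abs_add_le _ _).trans (add_le_add ((abs_dotProduct_le _ _).trans ?_) (hD t ht))
    exact mul_le_mul_of_nonneg_right (hC t ht) (eucl_nonneg _)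
  have hLS : ∀ t : ℝ, 0 ≤ t → ∃! ϑ : Fin n → ℝ, IsLeastSquares α β θ₀ φ z t ϑ := fun t ht =>
    (nonempty_filterRun α β 1 1 θ₀ hφ_cont hz_cont).some.existsUnique_isLeastSquares
      hα hφ_cont hz_cont ht
  refine ⟨hLS, fun γ hγ => ?_, fun γ hγ E θstar hstar => ?_, fun ρb hρb => ?_, ?_⟩
  · exact (nonempty_filterRun α β γ δ θ₀ hφ_cont hz_cont).some.nonempty_estimatorRun hα hκ hγ
  · obtain ⟨ρa, hρa, h⟩ := E.exists_error_decay hα hβ hγ hδ hκ hφ_cont hφ_bdd hz_cont hz_bdd hDE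
      hstar (half_lt_self hγ)
    exact ⟨ρa, γ / 2, hρa, half_pos hγ, h⟩
  · exact ⟨ρb, hρb, fun γ hγ E θstar hstar => E.exists_error_decay hα hβ (hρb.trans hγ) hδ hκ
      hφ_cont hφ_bdd hz_cont hz_bdd hDE hstar hγ⟩
  · intro hε T Φa Φb h Nd hNd γ hγ E
    have hz' : ∀ t : ℝ, 0 ≤ t → z t = φ t ⬝ᵥ θ := fun t ht => by rw [hz t ht, hε t ht, add_zero]
    exact E.exists_identifiable_decay hα hβ hδ hκ hφ_cont hφ_bdd hz_cont hz' h hNd hγ
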